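/- Let $p$ be a prime and let $n>2$ be an integer. A binary form of degree $n$ over $\mathrm{GF}(p)$ is a homogeneous polynomial $f(x,y)$ of degree $n$ with coefficients in $\mathrm{GF}(p)$; two forms are identified if one is a nonzero scalar multiple of the other. The group $G=\mathrm{GL}(2,p)$ acts on the right on the set $S$ of irreducible binary forms of degree $n$ (taken up to scalars) by $(fg)(x,y)=f(\alpha x+\beta y,\gamma x+\delta y)$ for $g=\begin{pmatrix}\alpha&\beta\\ \gamma&\delta\end{pmatrix}$. For $g\in G$ let $\mathrm{fix}(g)$ be the number of $s\in S$ with $sg=s$. Let $\mu$ be the Möbius function and $\varphi$ Euler's function. Put $$B(p,n)=\frac{p-1}{n}\sum_{d\mid n,\ p\nmid d}\mu(d)\,p^{n/(pd)}\ \text{ if } p\mid n,\qquad B(p,n)=0\ \text{ if } p\nmid n.$$ For $e\mid n$ write $n/e=kr$, where $k$ is the largest divisor of $n$ that is coprime to $e$, and put $$A(p,n,e)=\frac{\varphi(e)}{n}\sum_{d\mid k}\mu(d)\bigl(p^{kr/d}-1\bigr),\qquad C(p,n,e)=\frac{\varphi(e)}{n}\sum_{d\mid k}\mu(k/d)\bigl(p^{rd}-1+2(rd\bmod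 2)\bigr).$$ Then the number of orbits of $G$ on $S$ is $$\frac{a+b+c+d}{|G|},$$ where $$a=(p-1)\cdot\frac1n\sum_{d\mid n}\mu(d)p^{n/d},\qquad b=(p-1)(p^2-1)B(p,n),$$ $$c=\sum_{e\mid\gcd(n,p-1),\ e\ne1}\varphi(e)\,\frac{p-1}{2}\,(p^2+p)\,A(p,n,e),\qquad d=\sum_{e\mid\gcd(n,p+1),\ e\ne1}\varphi(e)\,\frac{p-1}{2}\,(p^2-p)\,C(p,n,e).$$ Moreover $a$, $b$, $c$ and $d$ are the sums of $\mathrm{fix}(g)$ over, respectively, the scalar matrices $g\in G$; the $g\in G$ conjugate to $\begin{pmatrix}\lambda&\lambda\\0&\lambda\end{pmatrix}$ for some $\lambda$; the $g\in G$ conjugate to $\begin{pmatrix}\lambda&0\\0&\nu\end{pmatrix}$ for some $\lambda\neq\nu$ (split semisimple elements); and the $g\in G$ with no eigenvalue in $\mathrm{GF}(p)$ (non-split elements). No condition relating $n$ and $p+1$ is imposed. -/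

import Mathlib

open MvPolynomial

open scoped MatrixGroups ArithmeticFunction.Moebius

noncomputable section

namespace BinaryForm

/-- The form `f(ax + by, cx + dy)` for the matrix `M` with rows `(a, b)` and `(c, d)`, where
`x = X 0` and `y = X 1`. -/
def subst {F : Type*} [Field F] (M : Matrix (Fin 2) (Fin 2) F) (f : MvPolynomial (Fin 2) F) :
    MvPolynomial (Fin 2) F :=
  aeval ![C (M 0 0) * X 0 + C (M 0 1) * X 1, C (M 1 0) * X 0 + C (M 1 1) * X 1] f

theorem subst_one {F : Type*} [Field F] (f : MvPolynomial (Fin 2) F) : subst 1 f = f := by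
  have h : (![C ((1 : Matrix (Fin 2) (Fin 2) F) 0 0) * X 0 +
      C ((1 : Matrix (Fin 2) (Fin 2) F) 0 1) * X 1,
      C ((1 : Matrix (Fin 2) (Fin 2) F) 1 0) * X 0 +
      C ((1 : Matrix (Fin 2) (Fin 2) F) 1 1) * X 1] : Fin 2 → MvPolynomial (Fin 2) F) = X := by
    funext i
    fin_cases i <;> simp
  rw [subst, h, aeval_X_left_apply]

theorem subst_mul {F : Type*} [Field F] (M N : Matrix (Fin 2) (Fin 2) F)
    (f : MvPolynomial (Fin 2) F) : subst (M * N) f = subst N (subst M f) := by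
  unfold subst
  rw [← AlgHom.comp_apply]
  congr 1
  apply MvPolynomial.algHom_ext
  intro i
  fin_cases i <;> simp [Matrix.mul_apply, Fin.sum_univ_two, algebraMap_eq] <;> ring

/-- Substitution of an invertible matrix as a ring automorphism. -/
def substEquiv {F : Type*} [Field F] (g : GL (Fin 2) F) :
    MvPolynomial (Fin 2) F ≃* MvPolynomial (Fin 2) F where
  toFun := subst (g : Matrix (Fin 2) (Fin 2) F)
  invFun := subst ((g⁻¹ : GL (Fin 2) F) : Matrix (Fin 2) (Fin 2) F)
  left_inv f := by
    rw [← subst_mul, ← Units.val_mul, mul_inv_cancel, Units.val_one, subst_one]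
  right_inv f := by
    rw [← subst_mul, ← Units.val_mul, inv_mul_cancel, Units.val_one, subst_one]
  map_mul' f h := map_mul _ f h

theorem subst_isHomogeneous {F : Type*} [Field F] (M : Matrix (Fin 2) (Fin 2) F) {n : ℕ}
    {f : MvPolynomial (Fin 2) F} (hf : f.IsHomogeneous n) : (subst M f).IsHomogeneous n := by
  have h : (subst M f).IsHomogeneous (1 * n) := by
    apply hf.aeval
    intro i
    fin_cases i <;>
      exact (isHomogeneous_C_mul_X _ _).add (isHomogeneous_C_mul_X _ _)
  rwa [one_mul] at h

theorem subst_irreducible {F : Type*} [Field F] (g : GL (Fin 2) F)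
    {f : MvPolynomial (Fin 2) F} (hf : Irreducible f) :
    Irreducible (subst (g : Matrix (Fin 2) (Fin 2) F) f) :=
  (MulEquiv.irreducible_iff (substEquiv g)).2 hf

/-- Irreducible homogeneous polynomials of degree `n` in two variables. -/
def IrreducibleForm (F : Type*) [Field F] (n : ℕ) : Type _ :=
  {f : MvPolynomial (Fin 2) F // f.IsHomogeneous n ∧ Irreducible f}

/-- Two forms are identified if one is a nonzero scalar multiple of the other. -/
def scalarSetoid (F : Type*) [Field F] (n : ℕ) : Setoid (IrreducibleForm F n) where
  r f h := ∃ c : F, c ≠ 0 ∧ h.1 = C c * f.1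
  iseqv :=
    { refl := fun f => ⟨1, one_ne_zero, by simp⟩
      symm := by
        rintro f h ⟨c, hc, e⟩
        refine ⟨c⁻¹, inv_ne_zero hc, ?_⟩
        rw [e, ← mul_assoc, ← C_mul, inv_mul_cancel₀ hc, C_1, one_mul]
      trans := by
        rintro f h k ⟨c, hc, e⟩ ⟨d, hd, e'⟩
        exact ⟨d * c, mul_ne_zero hd hc, by rw [e', e, C_mul, mul_assoc]⟩ }

/-- Irreducible binary forms of degree `n` over `F`, taken up to nonzero scalars. -/
def IrreducibleFormClass (F : Type*) [Field F] (n : ℕ) : Type _ :=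
  Quotient (scalarSetoid F n)

/-- The form `fg`. -/
def IrreducibleForm.act {F : Type*} [Field F] {n : ℕ} (g : GL (Fin 2) F)
    (f : IrreducibleForm F n) : IrreducibleForm F n :=
  ⟨subst (g : Matrix (Fin 2) (Fin 2) F) f.1, subst_isHomogeneous _ f.2.1,
    subst_irreducible g f.2.2⟩

/-- The right action of `GL(2, F)` on irreducible binary forms up to scalars. As usual, a right
action of a group is written as an action of the opposite group. -/
instance (F : Type*) [Field F] (n : ℕ) :
    MulAction (GL (Fin 2) F)ᵐᵒᵖ (IrreducibleFormClass F n) where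
  smul g := Quotient.map (IrreducibleForm.act g.unop) (by
    rintro f h ⟨c, hc, e⟩
    refine ⟨c, hc, ?_⟩
    change subst _ h.1 = C c * subst _ f.1
    rw [e, subst, map_mul, ← algebraMap_eq, AlgHom.commutes]
    rfl)
  one_smul s := by
    induction s using Quotient.inductionOn with
    | h f => exact congrArg (Quotient.mk _) (Subtype.ext (subst_one f.1))
  mul_smul g h s := by
    induction s using Quotient.inductionOn with
    | h f => exact congrArg (Quotient.mk _) (Subtype.ext (subst_mul h.unop.1 g.unop.1 f.1))

/-- The number of orbits of `GL(2, p)` on irreducible binary forms of degree `n` over `GF(p)`,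
taken up to scalars. -/
def numOrbits (p : ℕ) [Fact p.Prime] (n : ℕ) : ℕ :=
  Nat.card (MulAction.orbitRel.Quotient (GL (Fin 2) (ZMod p))ᵐᵒᵖ
    (IrreducibleFormClass (ZMod p) n))

/-- The number of irreducible binary forms (up to scalars) fixed by `g`. -/
def fix (p : ℕ) [Fact p.Prime] (n : ℕ) (g : GL (Fin 2) (ZMod p)) : ℕ :=
  Nat.card (MulAction.fixedBy (IrreducibleFormClass (ZMod p) n) (MulOpposite.op g))

/-- The scalar matrices. -/
def scalarMatrices (p : ℕ) [Fact p.Prime] : Set (GL (Fin 2) (ZMod p)) :=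
  {g | ∃ l : ZMod p, (g : Matrix (Fin 2) (Fin 2) (ZMod p)) = !![l, 0; 0, l]}

/-- The matrices conjugate to `(l l; 0 l)` for some `l`. -/
def nonsemisimpleMatrices (p : ℕ) [Fact p.Prime] : Set (GL (Fin 2) (ZMod p)) :=
  {g | ∃ (l : ZMod p) (h : GL (Fin 2) (ZMod p)),
    ((h * g * h⁻¹ : GL (Fin 2) (ZMod p)) : Matrix (Fin 2) (Fin 2) (ZMod p)) = !![l, l; 0, l]}

/-- The matrices conjugate to `(l 0; 0 m)` for some `l ≠ m`. -/
def splitMatrices (p : ℕ) [Fact p.Prime] : Set (GL (Fin 2) (ZMod p)) :=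
  {g | ∃ (l m : ZMod p) (h : GL (Fin 2) (ZMod p)), l ≠ m ∧
    ((h * g * h⁻¹ : GL (Fin 2) (ZMod p)) : Matrix (Fin 2) (Fin 2) (ZMod p)) = !![l, 0; 0, m]}

/-- The matrices with no eigenvalue in `GF(p)`. -/
def nonsplitMatrices (p : ℕ) [Fact p.Prime] : Set (GL (Fin 2) (ZMod p)) :=
  {g | ¬ ∃ l : ZMod p, (g : Matrix (Fin 2) (Fin 2) (ZMod p)).charpoly.IsRoot l}

/-- The largest divisor of `n` that is coprime to `e`. -/
def coprimePart (n e : ℕ) : ℕ :=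
  (n.divisors.filter fun d => d.Coprime e).sup id

/-- `A(p,n,e) = (φ(e)/n) ∑_{d ∣ k} μ(d) (p^{kr/d} - 1)`, where `n/e = kr` and `k` is the largest
divisor of `n` coprime to `e`. -/
def fnA (p n e : ℕ) : ℚ :=
  let k := coprimePart n e
  let r := n / e / k
  (e.totient : ℚ) / n * ∑ d ∈ k.divisors, (μ d : ℚ) * ((p : ℚ) ^ (k * r / d) - 1)

/-- `B(p,n) = ((p-1)/n) ∑_{d ∣ n, p ∤ d} μ(d) p^{n/(pd)}` if `p ∣ n`, and `0` otherwise. -/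
def fnB (p n : ℕ) : ℚ :=
  if p ∣ n then
    ((p : ℚ) - 1) / n *
      ∑ d ∈ n.divisors.filter (fun d => ¬ p ∣ d), (μ d : ℚ) * (p : ℚ) ^ (n / (p * d))
  else 0

/-- `C(p,n,e) = (φ(e)/n) ∑_{d ∣ k} μ(k/d) (p^{rd} - 1 + 2 (rd mod 2))`, where `n/e = kr` and `k` is
the largest divisor of `n` coprime to `e`. -/
def fnC (p n e : ℕ) : ℚ :=
  let k := coprimePart n e
  let r := n / e / k
  (e.totient : ℚ) / n *
    ∑ d ∈ k.divisors, (μ (k / d) : ℚ) * ((p : ℚ) ^ (r * d) - 1 + 2 * ((r * d % 2 : ℕ) : ℚ))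

/-- The contribution of the scalar matrices. -/
def terma (p n : ℕ) : ℚ :=
  ((p : ℚ) - 1) * (1 / n * ∑ d ∈ n.divisors, (μ d : ℚ) * (p : ℚ) ^ (n / d))

/-- The contribution of the non-semisimple matrices. -/
def termb (p n : ℕ) : ℚ :=
  ((p : ℚ) - 1) * ((p : ℚ) ^ 2 - 1) * fnB p n

/-- The contribution of the split semisimple matrices. -/
def termc (p n : ℕ) : ℚ :=
  ∑ e ∈ (n.gcd (p - 1)).divisors.erase 1,
    (e.totient : ℚ) * (((p : ℚ) - 1) / 2) * ((p : ℚ) ^ 2 + p) * fnA p n e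

/-- The contribution of the non-split matrices. -/
def termd (p n : ℕ) : ℚ :=
  ∑ e ∈ (n.gcd (p + 1)).divisors.erase 1,
    (e.totient : ℚ) * (((p : ℚ) - 1) / 2) * ((p : ℚ) ^ 2 - p) * fnC p n e

end BinaryForm

end

/-! ### Points on which a free cyclic twist follows the orbits of a map. -/

section Dynamics

open Function

/-! By Burnside, the number of orbits times `|G|` is the sum of `fix(g)` over `G`, and `G` splits
into the four kinds of matrices according to the eigenvalues and to being scalar or not. So the work
is to find `fix(g)` and to count matrices.

Over an algebraic closure `K`, a class of irreducible forms is the same as a Frobenius orbit of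
length `n`, the roots of `f(x, 1)`. The matrix `g` acts on roots as a Möbius map, and a class is
fixed exactly when this map sends a root into its own Frobenius orbit. Hence `n * fix(g)` counts
such roots (`fix_mul_eq_ncard`).

A good coordinate turns the Möbius map into the identity, `x ↦ x + 1`, or `u ↦ a * u` on `Kˣ`
(`ncard_conjugatedPts_eq`). Frobenius remains the `p`-th power, except for non-split `g`: it then
swaps the two fixed points of `g` and becomes `u ↦ u ^ (-p)`. In each case there is a map `F` and a
commuting `h` generating a free cyclic action of order `e` (`IsFreeTwist`). The equation `F^m x =
h^j x`, with `j` prime to `e`, is a separable polynomial equation with `p^m`, `p^m - 1` or `|(-p)^m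
- 1|` solutions, whatever `j` is. Sorting its solutions over all `j` by exact period gives a divisor
sum, which Möbius inversion solves (`IsFreeTwist.ncard_twistedPts`).

For the sums over `g`, matrices with given trace and determinant are counted (`card_traceDetFiber`).
The multiplier `a` ranges over the nontrivial elements of a cyclic group of order `p - 1` or `p +
1`, which has `φ(e)` elements of each order `e` (`sum_orderOf_of_isCyclic`). -/

theorem exists_mul_modEq_one {a e : ℕ} (he : 0 < e) (ha : a.Coprime e) :
    ∃ b, a * b ≡ 1 [MOD e] := by
  have : NeZero e := ⟨he.ne'⟩
  refine ⟨((a : ZMod e)⁻¹).val, ?_⟩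
  rw [← ZMod.natCast_eq_natCast_iff]
  simp [ZMod.coe_mul_inv_eq_one a ha]

theorem coprime_of_mul_modEq_one {a b e : ℕ} (h : a * b ≡ 1 [MOD e]) : b.Coprime e := by
  have := h.gcd_eq
  rw [Nat.gcd_one_left] at this
  exact Nat.Coprime.coprime_mul_left (Nat.coprime_iff_gcd_eq_one.2 this)

theorem coprime_of_dvd_div_gcd {a e : ℕ} (he : 0 < e) (h : e ∣ e / a.gcd e) : a.Coprime e := by
  have hg : 0 < a.gcd e := Nat.gcd_pos_of_pos_right _ he
  obtain ⟨t, ht⟩ := Nat.gcd_dvd_right a e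
  rw [Nat.coprime_iff_gcd_eq_one]
  generalize a.gcd e = g at *
  subst ht
  have ht : 0 < t := Nat.pos_of_mul_pos_left he
  rw [Nat.mul_div_cancel_left _ hg] at h
  have := Nat.le_of_dvd ht h
  nlinarith

theorem dvd_mul_div_gcd (a e : ℕ) : e ∣ a * (e / a.gcd e) := by
  rw [← Nat.mul_div_assoc _ (Nat.gcd_dvd_right a e), mul_comm,
    Nat.mul_div_assoc _ (Nat.gcd_dvd_left a e)]
  exact dvd_mul_right _ _

variable {X : Type*} {F h : X → X} {e : ℕ}

/-- The points of exact period `N` under `F` which `h` moves inside their `F`-orbit. -/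
def twistedPts (F h : X → X) (N : ℕ) : Set X :=
  {x | minimalPeriod F x = N ∧ ∃ i, h x = F^[i] x}

theorem Function.Commute.iterate_mul_eq (hc : Function.Commute F h) {x : X} {m i : ℕ}
    (hx : F^[m] x = h^[i] x) (j : ℕ) : F^[m * j] x = h^[i * j] x := by
  induction j with
  | zero => simp
  | succ j ih =>
    rw [mul_add, mul_one, iterate_add_apply, hx, (hc.iterate_iterate (m * j) i) x, ih,
      ← iterate_add_apply]
    rw [show i + i * j = i * (j + 1) by ring]

theorem Function.iterate_eq_iterate_of_modEq {x : X} {a b N : ℕ} (hN : minimalPeriod F x ∣ N)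
    (h : a ≡ b [MOD N]) : F^[a] x = F^[b] x := by
  rw [← iterate_mod_minimalPeriod_eq (n := a), ← iterate_mod_minimalPeriod_eq (n := b),
    (h.of_dvd hN : a % _ = b % _)]

/-- `h` commutes with `F` and generates a cyclic group of order `e` acting freely. -/
structure IsFreeTwist (F h : X → X) (e : ℕ) : Prop where
  pos : 0 < e
  comm : Function.Commute F h
  iterate_eq_iff : ∀ x i j, h^[i] x = h^[j] x ↔ i ≡ j [MOD e]

namespace IsFreeTwist

theorem iterate_eq_self_iff (H : IsFreeTwist F h e) {x : X} {i : ℕ} :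
    h^[i] x = x ↔ e ∣ i := by
  rw [← Nat.modEq_zero_iff_dvd, ← H.iterate_eq_iff x, iterate_zero, id]

/-- Iterating `h x = F^[i] x` over a full period gives `h^[N] x = x`, and the action is free. This
is why `fix` vanishes when the order of the multiplier does not divide `n`. -/
theorem dvd_of_mem (H : IsFreeTwist F h e) {N : ℕ} {x : X} (hx : x ∈ twistedPts F h N) :
    e ∣ N := by
  obtain ⟨rfl, i, hi⟩ := hx
  have h1 := H.comm.iterate_mul_eq (i := 1) hi.symm (minimalPeriod F x)
  rw [(isPeriodicPt_minimalPeriod F x).const_mul i, one_mul] at h1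
  exact H.iterate_eq_self_iff.1 h1.symm

theorem exists_eq_iterate (H : IsFreeTwist F h e) {x : X} {m j : ℕ} (hj : j.Coprime e)
    (hx : F^[m] x = h^[j] x) : ∃ i, h x = F^[i] x := by
  obtain ⟨t, ht⟩ := exists_mul_modEq_one H.pos hj
  refine ⟨m * t, ?_⟩
  rw [H.comm.iterate_mul_eq hx t]
  exact ((H.iterate_eq_iff x _ _).2 ht).symm

/-- On a cycle of length `e * m`, `h` is a rotation of order `e`, as is `F^[m]`. A cyclic group has
only one subgroup of order `e`, so each is a power of the other with exponent prime to `e`. -/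
theorem mem_twistedPts_iff (H : IsFreeTwist F h e) {m : ℕ} {x : X} :
    x ∈ twistedPts F h (e * m) ↔
      minimalPeriod F x = e * m ∧ ∃ j, j.Coprime e ∧ F^[m] x = h^[j] x := by
  constructor
  · rintro ⟨hN, i, hi⟩
    refine ⟨hN, ?_⟩
    have key : ∀ j, F^[i * j] x = h^[j] x := fun j => by
      simpa using H.comm.iterate_mul_eq (i := 1) hi.symm j
    have h1 : e * m ∣ e * i := by
      rw [← hN, mul_comm e i, ← isPeriodicPt_iff_minimalPeriod_dvd, IsPeriodicPt, IsFixedPt, key,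
        H.iterate_eq_self_iff]
    obtain ⟨t, rfl⟩ := Nat.dvd_of_mul_dvd_mul_left H.pos h1
    -- A common factor of `t` and `e` would make a smaller iterate `h^[e / gcd]` fix `x`.
    have h2 : t.Coprime e := by
      apply coprime_of_dvd_div_gcd H.pos
      rw [← H.iterate_eq_self_iff (x := x), ← key]
      change IsPeriodicPt F _ x
      rw [isPeriodicPt_iff_minimalPeriod_dvd, hN, mul_assoc, mul_comm e]
      exact mul_dvd_mul_left _ (dvd_mul_div_gcd _ _)
    obtain ⟨j, hj⟩ := exists_mul_modEq_one H.pos h2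
    refine ⟨j, coprime_of_mul_modEq_one hj, ?_⟩
    rw [← key]
    refine Function.iterate_eq_iterate_of_modEq hN.dvd ?_
    have := (hj.mul_left' m).symm
    rwa [mul_one, mul_comm m e, ← mul_assoc] at this
  · rintro ⟨hN, j, hj, hx⟩
    exact ⟨hN, H.exists_eq_iterate hj hx⟩

/-- The twisted analogue of "`F^m` fixes the points whose period divides `m`". Going from `F^[m /
d]` to `F^[m]` multiplies the exponent of `h` by `d`, so only `d` prime to `e` keep it prime to `e`.
-/
theorem exists_iterate_eq_iff (H : IsFreeTwist F h e) {m : ℕ} {x : X} (hm : 0 < m) :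
    (∃ j, j.Coprime e ∧ F^[m] x = h^[j] x) ↔
      ∃ d, d ∣ m ∧ d.Coprime e ∧ x ∈ twistedPts F h (e * (m / d)) := by
  have he := H.pos
  constructor
  · rintro ⟨j, hj, hx⟩
    have key := H.comm.iterate_mul_eq hx
    have h1 : minimalPeriod F x ∣ e * m := by
      rw [← isPeriodicPt_iff_minimalPeriod_dvd, IsPeriodicPt, IsFixedPt, mul_comm, key,
        H.iterate_eq_self_iff]
      exact dvd_mul_left _ _
    have hO : x ∈ twistedPts F h (minimalPeriod F x) := ⟨rfl, H.exists_eq_iterate hj hx⟩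
    obtain ⟨m', hm'⟩ := H.dvd_of_mem hO
    rw [hm'] at h1
    obtain ⟨d, rfl⟩ := Nat.dvd_of_mul_dvd_mul_left he h1
    have hd : 0 < d := Nat.pos_of_mul_pos_left hm
    refine ⟨d, dvd_mul_left _ _, ?_, ?_⟩
    · apply coprime_of_dvd_div_gcd he
      refine hj.symm.dvd_of_dvd_mul_left ?_
      rw [← H.iterate_eq_self_iff (x := x), ← key]
      change IsPeriodicPt F _ x
      rw [isPeriodicPt_iff_minimalPeriod_dvd, hm', mul_comm e, mul_assoc]
      exact mul_dvd_mul_left _ (dvd_mul_div_gcd _ _)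
    · rw [Nat.mul_div_cancel _ hd, ← hm']
      exact hO
  · rintro ⟨d, ⟨m', rfl⟩, hd, hx⟩
    have hd0 : 0 < d := Nat.pos_of_mul_pos_right hm
    rw [Nat.mul_div_cancel_left _ hd0, H.mem_twistedPts_iff] at hx
    obtain ⟨-, j, hj, hx⟩ := hx
    exact ⟨j * d, hj.mul_left hd, by rw [mul_comm, H.comm.iterate_mul_eq hx]⟩

/-- Freeness makes the solution sets of distinct residues `j` mod `e` disjoint, and `φ(e)` residues
are allowed. -/
theorem ncard_exists_iterate_eq (H : IsFreeTwist F h e) {m c : ℕ}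
    (hfin : ∀ j, j.Coprime e → {x | F^[m] x = h^[j] x}.Finite)
    (hcard : ∀ j, j.Coprime e → {x | F^[m] x = h^[j] x}.ncard = c) :
    {x | ∃ j, j.Coprime e ∧ F^[m] x = h^[j] x}.Finite ∧
      {x | ∃ j, j.Coprime e ∧ F^[m] x = h^[j] x}.ncard = e.totient * c := by
  classical
  set J := (Finset.range e).filter fun j => j.Coprime e with hJ
  have hJmem : ∀ {j}, j ∈ J ↔ j < e ∧ j.Coprime e := by simp [hJ]
  have hset : {x | ∃ j, j.Coprime e ∧ F^[m] x = h^[j] x} =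
      ⋃ j ∈ (J : Set ℕ), {x | F^[m] x = h^[j] x} := by
    ext x
    simp only [Set.mem_ofPred_eq, Set.mem_iUnion, Finset.mem_coe, hJmem, exists_prop]
    constructor
    · rintro ⟨j, hj, hx⟩
      refine ⟨j % e, ⟨Nat.mod_lt _ H.pos, ?_⟩, ?_⟩
      · rwa [Nat.Coprime, ← Nat.gcd_rec, Nat.gcd_comm]
      · rw [hx]
        exact (H.iterate_eq_iff x _ _).2 (Nat.mod_modEq j e).symm
    · rintro ⟨j, ⟨-, hj⟩, hx⟩
      exact ⟨j, hj, hx⟩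
  have hdisj : (J : Set ℕ).PairwiseDisjoint fun j => {x | F^[m] x = h^[j] x} := by
    intro i hi j hj hij
    rw [Function.onFun, Set.disjoint_left]
    intro x hx hx'
    refine hij (((H.iterate_eq_iff x _ _).1 (hx.symm.trans hx')).eq_of_lt_of_lt ?_ ?_)
    exacts [(hJmem.1 hi).1, (hJmem.1 hj).1]
  have hf : ∀ j ∈ (J : Set ℕ), {x | F^[m] x = h^[j] x}.Finite :=
    fun j hj => hfin j (hJmem.1 hj).2
  rw [hset]
  refine ⟨J.finite_toSet.biUnion hf, ?_⟩
  rw [Set.Finite.ncard_biUnion J.finite_toSet hf hdisj, finsum_mem_coe_finset,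
    Finset.sum_congr rfl fun j hj => hcard j (hJmem.1 hj).2, Finset.sum_const, smul_eq_mul,
    Nat.totient]
  congr 2
  ext j
  simp [hJ, Nat.coprime_comm]

theorem sum_ncard_twistedPts (H : IsFreeTwist F h e) {m c : ℕ} (hm : 0 < m)
    (hfin : ∀ j, j.Coprime e → {x | F^[m] x = h^[j] x}.Finite)
    (hcard : ∀ j, j.Coprime e → {x | F^[m] x = h^[j] x}.ncard = c) :
    ∑ d ∈ m.divisors with d.Coprime e, (twistedPts F h (e * (m / d))).ncard = e.totient * c := by
  obtain ⟨h1, h2⟩ := H.ncard_exists_iterate_eq hfin hcard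
  set D := m.divisors.filter fun d => d.Coprime e with hD
  have hDmem : ∀ {d}, d ∈ D ↔ d ∣ m ∧ d.Coprime e := by simp [hD, hm.ne']
  have hset : {x | ∃ j, j.Coprime e ∧ F^[m] x = h^[j] x} =
      ⋃ d ∈ (D : Set ℕ), twistedPts F h (e * (m / d)) := by
    ext x
    simp only [Set.mem_ofPred_eq, H.exists_iterate_eq_iff hm, Set.mem_iUnion, Finset.mem_coe, hDmem,
      exists_prop, and_assoc]
  have hdisj : (D : Set ℕ).PairwiseDisjoint fun d => twistedPts F h (e * (m / d)) := by
    intro i hi j hj hij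
    rw [Function.onFun, Set.disjoint_left]
    intro x hx hx'
    have := Nat.eq_of_mul_eq_mul_left H.pos (hx.1.symm.trans hx'.1)
    refine hij ?_
    rw [← Nat.div_div_self (hDmem.1 hi).1 hm.ne', this, Nat.div_div_self (hDmem.1 hj).1 hm.ne']
  rw [← h2, hset, Set.Finite.ncard_biUnion D.finite_toSet _ hdisj, finsum_mem_coe_finset]
  intro d hd
  refine h1.subset ?_
  rw [hset]
  exact Set.subset_biUnion_of_mem (u := fun d => twistedPts F h (e * (m / d))) hd

end IsFreeTwist

end Dynamics

/-! ### The coprime part of an integer, and Möbius inversion over its divisors. -/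

namespace BinaryForm

theorem coprimePart_spec {n : ℕ} (e : ℕ) (hn : n ≠ 0) :
    coprimePart n e ∣ n ∧ (coprimePart n e).Coprime e ∧
      ∀ d, d ∣ n → d.Coprime e → d ≤ coprimePart n e := by
  -- Since `1` belongs to the set, the supremum is attained and is not the default value `0`.
  have hne : (n.divisors.filter fun d => d.Coprime e).Nonempty := ⟨1, by simp [hn]⟩
  obtain ⟨k, hk, hk'⟩ := Finset.exists_mem_eq_sup _ hne id
  rw [Finset.mem_filter, Nat.mem_divisors] at hk
  refine ⟨?_, ?_, fun d hd hde => ?_⟩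
  · rw [coprimePart, hk']; exact hk.1.1
  · rw [coprimePart, hk']; exact hk.2
  · exact Finset.le_sup (f := id) (Finset.mem_filter.2 ⟨Nat.mem_divisors.2 ⟨hd, hn⟩, hde⟩)

/-- The largest such divisor is also a multiple of all others, because the lcm of two divisors prime
to `e` is again one. -/
theorem dvd_coprimePart {n e d : ℕ} (hn : n ≠ 0) (hd : d ∣ n) (hde : d.Coprime e) :
    d ∣ coprimePart n e := by
  obtain ⟨h1, h2, h3⟩ := coprimePart_spec e hn
  have hle := h3 _ (Nat.lcm_dvd hd h1)
    (Nat.Coprime.coprime_dvd_left (Nat.lcm_dvd_mul _ _) (hde.mul_left h2))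
  have hpos : 0 < d.lcm (coprimePart n e) :=
    Nat.pos_of_dvd_of_pos (Nat.lcm_dvd hd h1) (Nat.pos_of_ne_zero hn)
  rw [← Nat.le_antisymm hle (Nat.le_of_dvd hpos (Nat.dvd_lcm_right _ _))]
  exact Nat.dvd_lcm_left _ _

/-- The cofactor `r = n / e / k` has no divisor prime to `e` other than `1`: such a divisor `g`
would make `k * g` a larger admissible divisor of `n`. So the restricted divisor sum for `k' * r` is
an ordinary one over `k'`. -/
theorem dvd_mul_iff_dvd_coprimePart {n e d k' : ℕ} (hn : n ≠ 0) (he : e ∣ n)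
    (hk' : k' ∣ coprimePart n e) :
    (d ∣ k' * (n / e / coprimePart n e) ∧ d.Coprime e) ↔ d ∣ k' := by
  obtain ⟨h1, h2, h3⟩ := coprimePart_spec e hn
  set k := coprimePart n e
  have hkm : k ∣ n / e := by
    refine h2.dvd_of_dvd_mul_right ?_
    rwa [Nat.div_mul_cancel he]
  have hk0 : 0 < k := Nat.pos_of_dvd_of_pos h1 (Nat.pos_of_ne_zero hn)
  constructor
  · rintro ⟨hd, hde⟩
    have hcop : d.Coprime (n / e / k) := by
      have hg : (d.gcd (n / e / k)).Coprime e :=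
        Nat.Coprime.coprime_dvd_left (Nat.gcd_dvd_left _ _) hde
      have hle := h3 (k * d.gcd (n / e / k)) (dvd_trans (mul_dvd_mul_left k (Nat.gcd_dvd_right d _))
        (by rw [Nat.mul_div_cancel' hkm]; exact Nat.div_dvd_of_dvd he)) (h2.mul_left hg)
      have hpos : 0 < d.gcd (n / e / k) := by
        refine Nat.gcd_pos_of_pos_right _ (Nat.div_pos (Nat.le_of_dvd ?_ hkm) hk0)
        exact Nat.div_pos (Nat.le_of_dvd (Nat.pos_of_ne_zero hn) he)
          (Nat.pos_of_dvd_of_pos he (Nat.pos_of_ne_zero hn))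
      rw [Nat.coprime_iff_gcd_eq_one]
      nlinarith
    exact hcop.dvd_of_dvd_mul_right hd
  · exact fun hd => ⟨hd.mul_right _, (h2.coprime_dvd_left (hd.trans hk'))⟩

end BinaryForm

-- With `m = i * r` and `i ∣ k`, the identity `sum_ncard_twistedPts` becomes a full sum over the
-- divisors of `i`. It is needed only for `i ∣ k`, a set closed under divisors, and there it can be
-- inverted.
open BinaryForm ArithmeticFunction in
theorem IsFreeTwist.ncard_twistedPts {X : Type*} {F h : X → X} {e n : ℕ} (H : IsFreeTwist F h e)
    {c : ℕ → ℕ} (hn : n ≠ 0) (he : e ∣ n)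
    (hfin : ∀ m j, 0 < m → j.Coprime e → {x | F^[m] x = h^[j] x}.Finite)
    (hcard : ∀ m j, 0 < m → j.Coprime e → {x | F^[m] x = h^[j] x}.ncard = c m) :
    ((twistedPts F h n).ncard : ℚ) = e.totient * ∑ d ∈ (coprimePart n e).divisors,
      (μ (coprimePart n e / d) : ℚ) * (c (n / e / coprimePart n e * d) : ℚ) := by
  obtain ⟨h1, h2, -⟩ := coprimePart_spec e hn
  set k := coprimePart n e with hk
  set r := n / e / k with hr
  have hkm : k ∣ n / e := by
    refine h2.dvd_of_dvd_mul_right ?_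
    rwa [Nat.div_mul_cancel he]
  have hk0 : 0 < k := Nat.pos_of_dvd_of_pos h1 (Nat.pos_of_ne_zero hn)
  have hr0 : 0 < r := by
    refine (Nat.div_pos (Nat.le_of_dvd ?_ hkm) hk0)
    exact Nat.div_pos (Nat.le_of_dvd (Nat.pos_of_ne_zero hn) he) H.pos
  have key := (sum_eq_iff_sum_mul_moebius_eq_on (R := ℚ)
    (f := fun i => ((twistedPts F h (e * (r * i))).ncard : ℚ))
    (g := fun i => e.totient * (c (r * i) : ℚ)) {i | i ∣ k} (fun _ _ h h' => h.trans h')).1 ?_ k hk0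
      dvd_rfl
  · have hN : n = e * (r * k) := by
      rw [hr, Nat.div_mul_cancel hkm, Nat.mul_div_cancel' he]
    conv_lhs => rw [hN]
    rw [← key, Nat.sum_divisorsAntidiagonal' (f := fun a b => (μ a : ℚ) * (e.totient * c (r * b))),
      Finset.mul_sum]
    refine Finset.sum_congr rfl fun d _ => ?_
    ring
  · intro i hi hik
    have := H.sum_ncard_twistedPts (m := i * r) (Nat.mul_pos hi hr0)
      (fun j => hfin _ j (Nat.mul_pos hi hr0)) (fun j => hcard _ j (Nat.mul_pos hi hr0))
    rw [mul_comm r i, ← Nat.cast_mul, ← this, Nat.cast_sum]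
    have hset : ((i * r).divisors.filter fun d => d.Coprime e) = i.divisors := by
      ext d
      rw [Finset.mem_filter, Nat.mem_divisors, Nat.mem_divisors,
        ← dvd_mul_iff_dvd_coprimePart hn he hik]
      simp only [← hk, ← hr]
      have := (Nat.mul_pos hi hr0).ne'
      have := hi.ne'
      tauto
    rw [hset, ← Nat.sum_div_divisors]
    refine Finset.sum_congr rfl fun d hd => ?_
    rw [mul_comm r, Nat.div_mul_right_comm (Nat.dvd_of_mem_divisors hd)]

/-! ### Irreducible binary forms and irreducible polynomials in one variable. -/

namespace BinaryForm

section Dehomogenize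

variable {F : Type*} [Field F] {n : ℕ}

theorem IsHomogeneous.eq_zero_of_isUnit {f : MvPolynomial (Fin 2) F} (hf : f.IsHomogeneous n)
    (h : IsUnit f) : n = 0 := by
  by_contra hn
  have h1 : IsUnit (constantCoeff f) := h.map _
  rw [constantCoeff_eq, hf.coeff_eq_zero (by simpa using Ne.symm hn)] at h1
  exact not_isUnit_zero h1

/-- The polynomial `f(x, 1)`. -/
noncomputable def dehomogenize (f : MvPolynomial (Fin 2) F) : Polynomial F :=
  aeval ![Polynomial.X, 1] f

theorem homogenize_dehomogenize {f : MvPolynomial (Fin 2) F} (hf : f.IsHomogeneous n) :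
    (dehomogenize f).homogenize n = f :=
  Polynomial.homogenize_eq_of_isHomogeneous hf rfl

theorem natDegree_dehomogenize_le {f : MvPolynomial (Fin 2) F} (hf : f.IsHomogeneous n) :
    (dehomogenize f).natDegree ≤ n := by
  have := MvPolynomial.aeval_natDegree_le f hf.totalDegree_le ![Polynomial.X, 1] (n := 1)
    (fun i => by fin_cases i <;> simp)
  simpa [dehomogenize] using this

theorem isUnit_of_isUnit_homogenize {q : Polynomial F} (hq : q ≠ 0)
    (h : IsUnit (q.homogenize q.natDegree)) : IsUnit q := by
  have h0 := IsHomogeneous.eq_zero_of_isUnit (Polynomial.isHomogeneous_homogenize q) h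
  rw [Polynomial.eq_C_of_natDegree_eq_zero h0] at hq ⊢
  rw [Polynomial.isUnit_C]
  exact (by simpa using hq : q.coeff 0 ≠ 0).isUnit

/-- If the degree dropped, `f` would be `y` times a form of degree `n - 1`, and neither factor is a
unit when `n ≥ 2`. -/
theorem natDegree_dehomogenize (hn : 2 ≤ n) {f : MvPolynomial (Fin 2) F} (hf : f.IsHomogeneous n)
    (hi : Irreducible f) : (dehomogenize f).natDegree = n := by
  refine le_antisymm (natDegree_dehomogenize_le hf) (not_lt.1 fun hlt => ?_)
  have h1 := Polynomial.homogenize_mul (dehomogenize f) 1 (m := n - 1) (n := 1) (by omega) (by simp)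
  rw [mul_one, show n - 1 + 1 = n by omega, homogenize_dehomogenize hf] at h1
  rcases hi.isUnit_or_isUnit h1 with h | h
  · have := IsHomogeneous.eq_zero_of_isUnit (Polynomial.isHomogeneous_homogenize _) h
    omega
  · exact one_ne_zero (IsHomogeneous.eq_zero_of_isUnit (Polynomial.isHomogeneous_homogenize _) h)

theorem irreducible_dehomogenize (hn : 2 ≤ n) {f : MvPolynomial (Fin 2) F}
    (hf : f.IsHomogeneous n) (hi : Irreducible f) : Irreducible (dehomogenize f) := by
  have hdeg := natDegree_dehomogenize hn hf hi
  refine ⟨fun hu => ?_, fun a b hab => ?_⟩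
  · have := Polynomial.natDegree_eq_zero_of_isUnit hu
    omega
  · have h0 : a * b ≠ 0 := by
      rw [← hab]
      rintro h
      rw [h, Polynomial.natDegree_zero] at hdeg
      omega
    have ha := left_ne_zero_of_mul h0
    have hb := right_ne_zero_of_mul h0
    have h1 := Polynomial.homogenize_mul a b le_rfl le_rfl
    rw [← Polynomial.natDegree_mul ha hb, ← hab, hdeg, homogenize_dehomogenize hf] at h1
    exact (hi.isUnit_or_isUnit h1).imp (isUnit_of_isUnit_homogenize ha)
      (isUnit_of_isUnit_homogenize hb)

/-- A factor that becomes a unit at `y = 1` might a priori be a power of `y`. Total degrees exclude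
this: the other factor already accounts for the whole degree of `q`. -/
theorem irreducible_homogenize {q : Polynomial F} (hq : Irreducible q) :
    Irreducible (q.homogenize q.natDegree) := by
  have hne : q.homogenize q.natDegree ≠ 0 := by
    rw [Ne, Polynomial.homogenize_eq_zero_iff le_rfl]
    exact hq.ne_zero
  have htot := (Polynomial.isHomogeneous_homogenize (n := q.natDegree) q).totalDegree hne
  have hde : dehomogenize (q.homogenize q.natDegree) = q :=
    Polynomial.aeval_homogenize_X_one q le_rfl
  have key : ∀ a b : MvPolynomial (Fin 2) F, q.homogenize q.natDegree = a * b →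
      IsUnit (dehomogenize a) → IsUnit a := by
    intro a b hab hu
    have h0 : a * b ≠ 0 := hab ▸ hne
    rw [hab, totalDegree_mul_of_isDomain (left_ne_zero_of_mul h0) (right_ne_zero_of_mul h0)] at htot
    have h1 : q = dehomogenize a * dehomogenize b := by
      rw [← hde, hab, dehomogenize, map_mul]
      rfl
    have h2 : q.natDegree = (dehomogenize b).natDegree := by
      conv_lhs => rw [h1]
      rw [Polynomial.natDegree_mul hu.ne_zero
        (fun h => hq.ne_zero (by rw [h1, h, mul_zero])), Polynomial.natDegree_eq_zero_of_isUnit hu,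
        zero_add]
    have h3 := MvPolynomial.aeval_natDegree_le b le_rfl ![Polynomial.X, 1] (n := 1)
      (fun i => by fin_cases i <;> simp)
    rw [mul_one] at h3
    change (dehomogenize b).natDegree ≤ _ at h3
    have h4 : a.totalDegree = 0 := by omega
    rw [totalDegree_eq_zero_iff_eq_C] at h4
    have h5 : a ≠ 0 := left_ne_zero_of_mul h0
    rw [h4] at h5 ⊢
    exact IsUnit.map C (isUnit_iff_ne_zero.2 fun h => h5 (by rw [h, C_0]))
  refine ⟨fun hu => hq.not_isUnit ?_, fun a b hab => ?_⟩
  · rw [← hde]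
    exact hu.map (aeval ![Polynomial.X, 1])
  · have h1 : q = dehomogenize a * dehomogenize b := by
      rw [← hde, hab, dehomogenize, map_mul]
      rfl
    exact (hq.isUnit_or_isUnit h1).imp (key a b hab) (key b a (by rw [hab, mul_comm]))

variable {K : Type*} [Field K] [Algebra F K]

theorem aeval_dehomogenize (f : MvPolynomial (Fin 2) F) (θ : K) :
    Polynomial.aeval θ (dehomogenize f) = aeval ![θ, 1] f := by
  rw [dehomogenize, ← AlgHom.comp_apply]
  congr 1
  apply MvPolynomial.algHom_ext
  intro i
  fin_cases i <;> simp

theorem aeval_eq_aeval_div_mul {f : MvPolynomial (Fin 2) F} (hf : f.IsHomogeneous n)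
    {x : Fin 2 → K} (hx : x 1 ≠ 0) : aeval x f = aeval ![x 0 / x 1, 1] f * x 1 ^ n := by
  rw [← aeval_dehomogenize]
  conv_lhs => rw [← homogenize_dehomogenize hf]
  rw [aeval_def, ← eval_map, ← Polynomial.homogenize_map, Polynomial.eval_homogenize _ _ hx,
    Polynomial.eval_map_algebraMap]
  exact (Polynomial.natDegree_map_le).trans (natDegree_dehomogenize_le hf)

theorem aeval_subst_eq_zero_iff {f : MvPolynomial (Fin 2) F} (hf : f.IsHomogeneous n)
    (M : Matrix (Fin 2) (Fin 2) F) {θ : K}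
    (hθ : algebraMap F K (M 1 0) * θ + algebraMap F K (M 1 1) ≠ 0) :
    aeval ![θ, 1] (subst M f) = 0 ↔
      aeval ![(algebraMap F K (M 0 0) * θ + algebraMap F K (M 0 1)) /
        (algebraMap F K (M 1 0) * θ + algebraMap F K (M 1 1)), 1] f = 0 := by
  have h1 : aeval ![θ, 1] (subst M f) =
      aeval ![algebraMap F K (M 0 0) * θ + algebraMap F K (M 0 1),
        algebraMap F K (M 1 0) * θ + algebraMap F K (M 1 1)] f := by
    rw [subst, ← AlgHom.comp_apply]
    congr 1
    apply MvPolynomial.algHom_ext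
    intro i
    fin_cases i <;> simp
  rw [h1, aeval_eq_aeval_div_mul hf (by simpa using hθ)]
  simp [hθ]

end Dehomogenize

/-! ### Classes of forms as Frobenius orbits, and the action of matrices on roots. -/

section Roots

open Function

variable {p : ℕ} [Fact p.Prime] {n : ℕ}

theorem finite_setOf_minimalPeriod_frobenius_eq {K : Type*} [Field K] [CharP K p] (hn : 0 < n) :
    {θ : K | minimalPeriod (frobenius K p) θ = n}.Finite := by
  have hne : (Polynomial.X ^ p ^ n - Polynomial.X : Polynomial K) ≠ 0 :=
    FiniteField.X_pow_card_pow_sub_X_ne_zero K hn.ne' (Fact.out : p.Prime).one_lt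
  refine (Polynomial.rootSet_finite (Polynomial.X ^ p ^ n - Polynomial.X : Polynomial K) K).subset ?_
  intro θ hθ
  have := isPeriodicPt_minimalPeriod (frobenius K p) θ
  rw [hθ, IsPeriodicPt, IsFixedPt, iterate_frobenius] at this
  rw [Polynomial.mem_rootSet]
  exact ⟨hne, by simp [this]⟩

variable {K : Type*} [Field K] [Algebra (ZMod p) K] [CharP K p]

/-- Both numbers have the same multiples `m`: each divides `m` exactly when `q` divides `X^(p^m) -
X`. -/
theorem minimalPeriod_frobenius_of_aeval_eq_zero {q : Polynomial (ZMod p)} (hq : Irreducible q)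
    {θ : K} (hθ : Polynomial.aeval θ q = 0) : minimalPeriod (frobenius K p) θ = q.natDegree := by
  have key : ∀ m, minimalPeriod (frobenius K p) θ ∣ m ↔ q.natDegree ∣ m := by
    intro m
    rw [← isPeriodicPt_iff_minimalPeriod_dvd, hq.natDegree_dvd_iff_dvd_X_pow_card_pow_sub_X,
      ← hq.dvd_iff_aeval_eq_zero hθ, IsPeriodicPt, IsFixedPt, iterate_frobenius]
    simp [sub_eq_zero]
  exact Nat.dvd_antisymm ((key _).2 dvd_rfl) ((key _).1 dvd_rfl)

theorem aeval_iterate_frobenius_eq_zero {q : Polynomial (ZMod p)} {θ : K}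
    (hθ : Polynomial.aeval θ q = 0) (i : ℕ) :
    Polynomial.aeval ((frobenius K p)^[i] θ) q = 0 := by
  induction i with
  | zero => exact hθ
  | succ i ih =>
    rw [iterate_succ_apply', frobenius_def, ← Polynomial.expand_aeval, ZMod.expand_card, map_pow,
      ih, zero_pow (Fact.out : p.Prime).ne_zero]

/-- The Frobenius orbit of `θ` supplies `q.natDegree` distinct roots, and there can be no more. -/
theorem setOf_aeval_eq_zero {q : Polynomial (ZMod p)} (hq : Irreducible q)
    {θ : K} (hθ : Polynomial.aeval θ q = 0) :
    {η : K | Polynomial.aeval η q = 0} = Set.range (fun i => (frobenius K p)^[i] θ) ∧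
      {η : K | Polynomial.aeval η q = 0}.ncard = q.natDegree := by
  classical
  have hper := minimalPeriod_frobenius_of_aeval_eq_zero hq hθ
  set S := (Finset.range q.natDegree).image fun i => (frobenius K p)^[i] θ with hS
  have hcard : S.card = q.natDegree := by
    rw [hS, Finset.card_image_of_injOn, Finset.card_range]
    rw [← hper]
    intro i hi j hj hij
    simp only [Finset.coe_range, Set.mem_Iio] at hi hj
    exact (iterate_eq_iterate_iff_of_lt_minimalPeriod hi hj).1 hij
  have hroots : {η : K | Polynomial.aeval η q = 0} = (q.rootSet K) := by
    ext η
    simp [Polynomial.mem_rootSet, hq.ne_zero]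
  have hsub : (S : Set K) ⊆ q.rootSet K := by
    rw [← hroots]
    intro η hη
    rw [Finset.mem_coe, hS, Finset.mem_image] at hη
    obtain ⟨i, -, rfl⟩ := hη
    exact aeval_iterate_frobenius_eq_zero hθ i
  have hle : (q.rootSet K).ncard ≤ q.natDegree := Polynomial.ncard_rootSet_le q K
  have heq : (S : Set K) = q.rootSet K :=
    Set.eq_of_subset_of_ncard_le hsub (by rwa [Set.ncard_coe_finset, hcard])
      (Polynomial.rootSet_finite q K)
  refine ⟨subset_antisymm ?_ ?_, ?_⟩
  · rw [hroots, ← heq, hS]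
    intro η hη
    rw [Finset.mem_coe, Finset.mem_image] at hη
    obtain ⟨i, -, rfl⟩ := hη
    exact ⟨i, rfl⟩
  · rintro _ ⟨i, rfl⟩
    exact aeval_iterate_frobenius_eq_zero hθ i
  · rw [hroots, ← heq, Set.ncard_coe_finset, hcard]

theorem isIntegral_of_minimalPeriod_pos {θ : K} (h : 0 < minimalPeriod (frobenius K p) θ) :
    IsIntegral (ZMod p) θ := by
  set m := minimalPeriod (frobenius K p) θ with hm
  refine ⟨Polynomial.X ^ p ^ m - Polynomial.X, ?_, ?_⟩
  · exact Polynomial.monic_X_pow_sub (by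
      rw [Polynomial.degree_X]
      exact_mod_cast Nat.one_lt_pow h.ne' (Fact.out : p.Prime).one_lt)
  · have := isPeriodicPt_minimalPeriod (frobenius K p) θ
    rw [← hm, IsPeriodicPt, IsFixedPt, iterate_frobenius] at this
    simp [this]

theorem minimalPeriod_frobenius_algebraMap (a : ZMod p) :
    minimalPeriod (frobenius K p) (algebraMap (ZMod p) K a) = 1 := by
  rw [minimalPeriod_eq_one_iff_isFixedPt, IsFixedPt, frobenius_def, ← map_pow, ZMod.pow_card]

/-- An element outside `GF(p)` cannot be a pole of a Möbius map over `GF(p)`. -/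
theorem mul_add_ne_zero {θ : K} (hθ : 1 < minimalPeriod (frobenius K p) θ) {c d : ZMod p}
    (h : c ≠ 0 ∨ d ≠ 0) : algebraMap (ZMod p) K c * θ + algebraMap (ZMod p) K d ≠ 0 := by
  intro h0
  by_cases hc : c = 0
  · rw [hc, map_zero, zero_mul, zero_add, map_eq_zero] at h0
    simp [hc, h0] at h
  · have hc' : algebraMap (ZMod p) K c ≠ 0 := by simpa using hc
    have : θ = algebraMap (ZMod p) K (-d / c) := by
      rw [map_div₀, map_neg]
      field_simp
      linear_combination h0
    rw [this, minimalPeriod_frobenius_algebraMap] at hθ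
    omega

theorem row_ne_zero (g : GL (Fin 2) (ZMod p)) : g 1 0 ≠ 0 ∨ g 1 1 ≠ 0 := by
  by_contra! h
  have := g.det.ne_zero
  rw [Matrix.GeneralLinearGroup.val_det_apply, Matrix.det_fin_two] at this
  simp [h.1, h.2] at this

variable (K) in
/-- The roots `θ` of `f(x, 1)` in `K`. -/
def IrreducibleFormClass.roots (s : IrreducibleFormClass (ZMod p) n) : Set K :=
  Quotient.lift (fun f : IrreducibleForm (ZMod p) n => {θ : K | aeval ![θ, 1] f.1 = 0})
    (by
      rintro f h ⟨c, hc, e⟩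
      ext θ
      simp [e, hc]) s

namespace IrreducibleFormClass

theorem roots_mk {K : Type*} [Field K] [Algebra (ZMod p) K] (f : IrreducibleForm (ZMod p) n) :
    roots K (Quotient.mk _ f) = {θ : K | Polynomial.aeval θ (dehomogenize f.1) = 0} := by
  ext θ
  simp only [roots, Quotient.lift_mk, aeval_dehomogenize]

theorem minimalPeriod_of_mem_roots (hn : 2 ≤ n) {s : IrreducibleFormClass (ZMod p) n} {θ : K}
    (hθ : θ ∈ roots K s) : minimalPeriod (frobenius K p) θ = n := by
  induction s using Quotient.inductionOn with
  | h f =>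
    rw [roots_mk] at hθ
    rw [minimalPeriod_frobenius_of_aeval_eq_zero (irreducible_dehomogenize hn f.2.1 f.2.2) hθ,
      natDegree_dehomogenize hn f.2.1 f.2.2]

theorem roots_eq_range (hn : 2 ≤ n) {s : IrreducibleFormClass (ZMod p) n} {θ : K}
    (hθ : θ ∈ roots K s) : roots K s = Set.range fun i => (frobenius K p)^[i] θ := by
  induction s using Quotient.inductionOn with
  | h f =>
    rw [roots_mk] at hθ ⊢
    exact (setOf_aeval_eq_zero (irreducible_dehomogenize hn f.2.1 f.2.2) hθ).1

theorem roots_nonempty {K : Type*} [Field K] [Algebra (ZMod p) K] [IsAlgClosed K] (hn : 2 ≤ n)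
    (s : IrreducibleFormClass (ZMod p) n) :
    (roots K s).Nonempty := by
  induction s using Quotient.inductionOn with
  | h f =>
    rw [roots_mk]
    refine IsAlgClosed.exists_aeval_eq_zero K _ ?_
    exact (Polynomial.degree_pos_of_irreducible (irreducible_dehomogenize hn f.2.1 f.2.2)).ne'

theorem ncard_roots [IsAlgClosed K] (hn : 2 ≤ n) (s : IrreducibleFormClass (ZMod p) n) :
    (roots K s).ncard = n := by
  obtain ⟨θ, hθ⟩ := roots_nonempty (K := K) hn s
  induction s using Quotient.inductionOn with
  | h f =>
    rw [roots_mk] at hθ ⊢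
    rw [(setOf_aeval_eq_zero (irreducible_dehomogenize hn f.2.1 f.2.2) hθ).2,
      natDegree_dehomogenize hn f.2.1 f.2.2]

/-- Irreducible polynomials with a common root are associated, and homogenizing keeps the scalar.
Thus one shared root identifies a class. -/
theorem eq_of_mem_roots {K : Type*} [Field K] [Algebra (ZMod p) K] (hn : 2 ≤ n)
    {s t : IrreducibleFormClass (ZMod p) n} {θ : K}
    (hs : θ ∈ roots K s) (ht : θ ∈ roots K t) : s = t := by
  induction s, t using Quotient.inductionOn₂ with
  | h f h =>
    rw [roots_mk] at hs ht
    have hf := irreducible_dehomogenize hn f.2.1 f.2.2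
    have hh := irreducible_dehomogenize hn h.2.1 h.2.2
    obtain ⟨u, hu⟩ := hf.associated_of_dvd hh ((hf.dvd_iff_aeval_eq_zero hs).1 ht)
    obtain ⟨c, hc, hcu⟩ := Polynomial.isUnit_iff.1 u.isUnit
    refine Quotient.sound ⟨c, hc.ne_zero, ?_⟩
    rw [← homogenize_dehomogenize h.2.1, ← hu, ← hcu, mul_comm, Polynomial.homogenize_C_mul,
      homogenize_dehomogenize f.2.1]

theorem exists_mem_roots (hn : 0 < n) {θ : K} (hθ : minimalPeriod (frobenius K p) θ = n) :
    ∃ s : IrreducibleFormClass (ZMod p) n, θ ∈ roots K s := by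
  have hint : IsIntegral (ZMod p) θ := isIntegral_of_minimalPeriod_pos (p := p) (by omega)
  have hirr := minpoly.irreducible hint
  have hdeg : (minpoly (ZMod p) θ).natDegree = n := by
    rw [← hθ, minimalPeriod_frobenius_of_aeval_eq_zero hirr (minpoly.aeval _ _)]
  let f : IrreducibleForm (ZMod p) n := ⟨(minpoly (ZMod p) θ).homogenize n,
    Polynomial.isHomogeneous_homogenize _, hdeg ▸ irreducible_homogenize hirr⟩
  refine ⟨Quotient.mk _ f, ?_⟩
  rw [roots_mk]
  change Polynomial.aeval θ (aeval ![Polynomial.X, 1] ((minpoly (ZMod p) θ).homogenize n)) = 0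
  rw [Polynomial.aeval_homogenize_X_one _ hdeg.le, minpoly.aeval]

theorem mem_roots_smul {g : GL (Fin 2) (ZMod p)} {s : IrreducibleFormClass (ZMod p) n} {θ : K}
    (hθ : 1 < minimalPeriod (frobenius K p) θ) :
    θ ∈ roots K (MulOpposite.op g • s) ↔
      (algebraMap (ZMod p) K (g 0 0) * θ + algebraMap (ZMod p) K (g 0 1)) /
        (algebraMap (ZMod p) K (g 1 0) * θ + algebraMap (ZMod p) K (g 1 1)) ∈ roots K s := by
  induction s using Quotient.inductionOn with
  | h f => exact aeval_subst_eq_zero_iff f.2.1 _ (mul_add_ne_zero hθ (row_ne_zero g))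

theorem finite (hn : 2 ≤ n) : Finite (IrreducibleFormClass (ZMod p) n) := by
  let K := AlgebraicClosure (ZMod p)
  choose r hr using roots_nonempty (K := K) (p := p) hn
  have hfin := finite_setOf_minimalPeriod_frobenius_eq (p := p) (K := K) (n := n) (by omega)
  have := hfin.to_subtype
  refine Finite.of_injective
    (fun s => (⟨r s, minimalPeriod_of_mem_roots hn (hr s)⟩ :
      {θ : K | minimalPeriod (frobenius K p) θ = n})) fun s t hst => ?_
  refine eq_of_mem_roots hn (hr s) ?_
  rw [show r s = r t from congrArg Subtype.val hst]
  exact hr t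

end IrreducibleFormClass

variable (K) in
/-- The elements of degree `n` whose image under the fractional linear map given by `g` is one of
their conjugates. -/
def conjugatedPts (n : ℕ) (g : GL (Fin 2) (ZMod p)) : Set K :=
  {θ | minimalPeriod (frobenius K p) θ = n ∧ ∃ i,
    (algebraMap (ZMod p) K (g 0 0) * θ + algebraMap (ZMod p) K (g 0 1)) =
      (algebraMap (ZMod p) K (g 1 0) * θ + algebraMap (ZMod p) K (g 1 1)) *
        (frobenius K p)^[i] θ}

-- The set on the right is the disjoint union of the root sets of the fixed classes, each of size
-- `n`. One root decides whether a class is fixed, since its image lies among the roots exactly when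
-- it lies in the Frobenius orbit.
open IrreducibleFormClass in
variable (K) in
theorem fix_mul_eq_ncard [IsAlgClosed K] (hn : 2 ≤ n) (g : GL (Fin 2) (ZMod p)) :
    fix p n g * n = (conjugatedPts K n g).ncard := by
  have := IrreducibleFormClass.finite (p := p) hn
  set S := MulAction.fixedBy (IrreducibleFormClass (ZMod p) n) (MulOpposite.op g) with hS
  have hset : conjugatedPts K n g = ⋃ s ∈ S, roots K s := by
    ext θ
    simp only [Set.mem_iUnion, exists_prop]
    have key : ∀ s, minimalPeriod (frobenius K p) θ = n → θ ∈ roots K s →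
        (s ∈ S ↔ ∃ i, (algebraMap (ZMod p) K (g 0 0) * θ + algebraMap (ZMod p) K (g 0 1)) =
          (algebraMap (ZMod p) K (g 1 0) * θ + algebraMap (ZMod p) K (g 1 1)) *
            (frobenius K p)^[i] θ) := by
      intro s hper hs
      have hper' : 1 < minimalPeriod (frobenius K p) θ := by omega
      have h1 : s ∈ S ↔ θ ∈ roots K (MulOpposite.op g • s) := by
        rw [hS, MulAction.mem_fixedBy]
        exact ⟨fun h => h.symm ▸ hs, fun h => eq_of_mem_roots hn h hs⟩
      rw [h1, mem_roots_smul hper', roots_eq_range hn hs, Set.mem_range]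
      refine exists_congr fun i => ?_
      rw [eq_comm, div_eq_iff (mul_add_ne_zero hper' (row_ne_zero g)),
        mul_comm ((frobenius K p)^[i] θ)]
    constructor
    · rintro ⟨hper, hi⟩
      obtain ⟨s, hs⟩ := exists_mem_roots (p := p) (n := n) (by omega) hper
      exact ⟨s, (key s hper hs).2 hi, hs⟩
    · rintro ⟨s, hsS, hs⟩
      have hper := minimalPeriod_of_mem_roots hn hs
      exact ⟨hper, (key s hper hs).1 hsS⟩
  rw [hset, Set.Finite.ncard_biUnion S.toFinite,
    finsum_mem_eq_finite_toFinset_sum _ S.toFinite,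
    Finset.sum_congr rfl fun s _ => ncard_roots (K := K) hn s, Finset.sum_const, smul_eq_mul, fix,
    ← Set.ncard_eq_toFinset_card]
  · rfl
  · intro s _
    exact Set.finite_of_ncard_pos (by rw [ncard_roots hn]; omega)
  · intro s _ t _ hst
    rw [Function.onFun, Set.disjoint_left]
    exact fun θ hs ht => hst (eq_of_mem_roots hn hs ht)

end Roots

end BinaryForm

/-! ### Numbers of solutions of the twisted equations in an algebraically closed field. -/

namespace BinaryForm

open Function

section Counting

variable {K : Type*} [Field K] [IsAlgClosed K]

theorem ncard_roots_of_separable {q : Polynomial K} (hq : q.Separable) :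
    {x : K | q.eval x = 0}.Finite ∧ {x : K | q.eval x = 0}.ncard = q.natDegree := by
  have h : {x : K | q.eval x = 0} = q.rootSet K := by
    ext x
    simp [Polynomial.mem_rootSet, hq.ne_zero]
  rw [h]
  refine ⟨Polynomial.rootSet_finite q K, ?_⟩
  rw [← Nat.card_coe_set_eq, Nat.card_eq_fintype_card,
    Polynomial.card_rootSet_eq_natDegree hq (IsAlgClosed.splits_domain _)]

/-- The polynomial has derivative `-1`, so it is separable. -/
theorem ncard_pow_eq_add {p : ℕ} [Fact p.Prime] [CharP K p] {m : ℕ} (hm : 0 < m) (a : K) :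
    {x : K | x ^ p ^ m = x + a}.Finite ∧ {x : K | x ^ p ^ m = x + a}.ncard = p ^ m := by
  have h1 : 1 < p ^ m := Nat.one_lt_pow hm.ne' (Fact.out : p.Prime).one_lt
  set q : Polynomial K := Polynomial.X ^ p ^ m - (Polynomial.X + Polynomial.C a) with hq
  have hder : Polynomial.derivative q = -1 := by
    simp [hq, Polynomial.derivative_X_pow, hm.ne']
  have hsep : q.Separable := by
    rw [Polynomial.separable_def, hder]
    exact isCoprime_one_right.neg_right
  have hdeg : q.natDegree = p ^ m := by
    rw [hq, Polynomial.natDegree_sub_eq_left_of_natDegree_lt, Polynomial.natDegree_X_pow]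
    rwa [Polynomial.natDegree_X_add_C, Polynomial.natDegree_X_pow]
  have h2 := ncard_roots_of_separable hsep
  rw [hdeg] at h2
  have h : {x : K | x ^ p ^ m = x + a} = {x : K | q.eval x = 0} := by
    ext x
    simp [hq, sub_eq_zero]
  rwa [h]

theorem ncard_units_pow_eq {N : ℕ} (hN : (N : K) ≠ 0) (b : Kˣ) :
    {u : Kˣ | u ^ N = b}.Finite ∧ {u : Kˣ | u ^ N = b}.ncard = N := by
  have hN0 : N ≠ 0 := by
    rintro rfl
    simp at hN
  have h1 := ncard_roots_of_separable (Polynomial.separable_X_pow_sub_C (b : K) hN b.ne_zero)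
  rw [Polynomial.natDegree_X_pow_sub_C] at h1
  have h2 : {x : K | (Polynomial.X ^ N - Polynomial.C (b : K)).eval x = 0} =
      Units.val '' {u : Kˣ | u ^ N = b} := by
    ext x
    simp only [Polynomial.eval_sub, Polynomial.eval_pow, Polynomial.eval_X, Polynomial.eval_C,
      sub_eq_zero, Set.mem_ofPred_eq, Set.mem_image]
    constructor
    · intro hx
      have hx0 : x ≠ 0 := by
        rintro rfl
        rw [zero_pow hN0] at hx
        exact b.ne_zero hx.symm
      exact ⟨Units.mk0 x hx0, Units.ext (by simpa using hx), rfl⟩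
    · rintro ⟨u, hu, rfl⟩
      rw [← hu, Units.val_pow_eq_pow_val]
  rw [h2, Set.ncard_image_of_injective _ Units.val_injective] at h1
  exact ⟨h1.1.of_finite_image Units.val_injective.injOn, h1.2⟩

theorem ncard_units_zpow_eq {z : ℤ} (hz : (z : K) ≠ 0) (b : Kˣ) :
    {u : Kˣ | u ^ z = b}.Finite ∧ {u : Kˣ | u ^ z = b}.ncard = z.natAbs := by
  obtain ⟨N, rfl | rfl⟩ := z.eq_nat_or_neg
  · simpa using ncard_units_pow_eq (N := N) (by simpa using hz) b
  · have h : {u : Kˣ | u ^ (-(N : ℤ)) = b} = {u : Kˣ | u ^ N = b⁻¹} := by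
      ext u
      simp [inv_eq_iff_eq_inv]
    rw [h, Int.natAbs_neg, Int.natAbs_natCast]
    exact ncard_units_pow_eq (N := N) (by simpa using hz) b⁻¹

theorem iterate_zpow {G : Type*} [Group G] (z : ℤ) (m : ℕ) (u : G) :
    (fun u : G => u ^ z)^[m] u = u ^ z ^ m := by
  induction m with
  | zero => simp
  | succ m ih => rw [iterate_succ_apply', ih, ← zpow_mul, pow_succ]

theorem isFreeTwist_zpow {G : Type*} [CommGroup G] {z : ℤ} {a : G} (ha : a ^ z = a)
    (ha' : IsOfFinOrder a) : IsFreeTwist (fun u : G => u ^ z) (fun u => a * u) (orderOf a) where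
  pos := ha'.orderOf_pos
  comm u := by simp [mul_zpow, ha]
  iterate_eq_iff x i j := by
    simp only [mul_left_iterate, mul_left_inj, pow_eq_pow_iff_modEq]

/-- The twisted equation reads `u ^ (z ^ m - 1) = a ^ j`; its exponent equals `-1` in `K`, so there
are `|z ^ m - 1|` solutions. The cases `z = p` and `z = -p` serve split and non-split matrices. -/
theorem ncard_twistedPts_zpow {n : ℕ} (hn : n ≠ 0) {z : ℤ} (hz : (z : K) = 0) {a : Kˣ}
    (ha : a ^ z = a) (ha' : IsOfFinOrder a) (he : orderOf a ∣ n) :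
    ((twistedPts (fun u : Kˣ => u ^ z) (fun u => a * u) n).ncard : ℚ) =
      (orderOf a).totient * ∑ d ∈ (coprimePart n (orderOf a)).divisors,
        (μ (coprimePart n (orderOf a) / d) : ℚ) *
          ((z ^ (n / orderOf a / coprimePart n (orderOf a) * d) - 1).natAbs : ℚ) := by
  have key : ∀ m j, 0 < m →
      {u : Kˣ | (fun u : Kˣ => u ^ z)^[m] u = (fun u => a * u)^[j] u} =
        {u : Kˣ | u ^ (z ^ m - 1) = a ^ j} := by
    intro m j _
    ext u
    simp [iterate_zpow, zpow_sub, mul_inv_eq_iff_eq_mul]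
  have hne : ∀ m, 0 < m → ((z ^ m - 1 : ℤ) : K) ≠ 0 := by
    intro m hm
    simp [hz, hm.ne']
  refine (isFreeTwist_zpow ha ha').ncard_twistedPts (c := fun m => (z ^ m - 1).natAbs) hn he ?_ ?_
  · intro m j hm _
    rw [key m j hm]
    exact (ncard_units_zpow_eq (hne m hm) _).1
  · intro m j hm _
    rw [key m j hm]
    exact (ncard_units_zpow_eq (hne m hm) _).2

theorem isFreeTwist_add_natCast {K : Type*} [Field K] {p : ℕ} [Fact p.Prime] [CharP K p] :
    IsFreeTwist (frobenius K p) (fun x => x + 1) p where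
  pos := (Fact.out : p.Prime).pos
  comm x := by simp
  iterate_eq_iff x i j := by
    simp [CharP.natCast_eq_natCast K p]

end Counting

section Totals

theorem divisors_coprimePart {n : ℕ} (e : ℕ) (hn : n ≠ 0) :
    (coprimePart n e).divisors = n.divisors.filter fun d => d.Coprime e := by
  obtain ⟨h1, h2, -⟩ := coprimePart_spec e hn
  ext d
  rw [Finset.mem_filter, Nat.mem_divisors, Nat.mem_divisors]
  constructor
  · rintro ⟨hd, -⟩
    exact ⟨⟨hd.trans h1, hn⟩, h2.coprime_dvd_left hd⟩
  · rintro ⟨⟨hd, -⟩, hde⟩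
    exact ⟨dvd_coprimePart hn hd hde, fun h => hn (Nat.eq_zero_of_zero_dvd (h ▸ h1))⟩

/-- Replaces `d` by its complementary divisor, which gives the shape of the sums in `terma` (`e =
1`) and `fnB` (`e = p`). -/
theorem sum_divisors_coprimePart {n e : ℕ} (hn : n ≠ 0) (he : e ∣ n) (c : ℕ → ℚ) :
    ∑ d ∈ (coprimePart n e).divisors,
      (μ (coprimePart n e / d) : ℚ) * c (n / e / coprimePart n e * d) =
    ∑ d ∈ n.divisors with d.Coprime e, (μ d : ℚ) * c (n / (e * d)) := by
  obtain ⟨h1, h2, -⟩ := coprimePart_spec e hn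
  rw [← divisors_coprimePart e hn, ← Nat.sum_div_divisors]
  set k := coprimePart n e
  have hkm : k ∣ n / e := h2.dvd_of_dvd_mul_right (by rwa [Nat.div_mul_cancel he])
  refine Finset.sum_congr rfl fun d hd => ?_
  have hdk := Nat.dvd_of_mem_divisors hd
  rw [Nat.div_div_self hdk (Nat.mem_divisors.1 hd).2,
    ← Nat.mul_div_assoc _ hdk, Nat.div_mul_cancel hkm, Nat.div_div_eq_div_mul]

end Totals

/-! ### Values of `fix` on scalar, unipotent-type and diagonal matrices. -/

section Values

variable {p : ℕ} [Fact p.Prime] {n : ℕ} {K : Type*} [Field K] [Algebra (ZMod p) K] [CharP K p]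

/-- Change of coordinate: `w` carries `F` to Frobenius and `h` to the Möbius map. The set `U` leaves
room for a point, such as the one over infinity, where `w` has no meaning; no point of period `n` is
lost. -/
theorem ncard_conjugatedPts_eq {X : Type*} {g : GL (Fin 2) (ZMod p)} {F h : X → X} (w : X → K)
    (U : Set X) (hU : Set.MapsTo F U U) (hinj : Set.InjOn w U)
    (hF : ∀ u ∈ U, frobenius K p (w u) = w (F u))
    (hsurj : ∀ θ, minimalPeriod (frobenius K p) θ = n → ∃ u ∈ U, w u = θ)
    (hper : ∀ u, minimalPeriod F u = n → u ∈ U)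
    (hrel : ∀ u ∈ U, ∀ v ∈ U,
      algebraMap (ZMod p) K (g 0 0) * w u + algebraMap (ZMod p) K (g 0 1) =
        (algebraMap (ZMod p) K (g 1 0) * w u + algebraMap (ZMod p) K (g 1 1)) * w v ↔ h u = v) :
    (conjugatedPts K n g).ncard = (twistedPts F h n).ncard := by
  have hiter : ∀ i, ∀ u ∈ U, F^[i] u ∈ U ∧ (frobenius K p)^[i] (w u) = w (F^[i] u) := by
    intro i
    induction i with
    | zero => exact fun u hu => ⟨hu, rfl⟩
    | succ i ih =>
      intro u hu
      rw [iterate_succ_apply', iterate_succ_apply', (ih u hu).2, hF _ (ih u hu).1]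
      exact ⟨hU (ih u hu).1, rfl⟩
  have hmin : ∀ u ∈ U, minimalPeriod (frobenius K p) (w u) = minimalPeriod F u := by
    intro u hu
    rw [minimalPeriod_eq_minimalPeriod_iff]
    intro m
    rw [IsPeriodicPt, IsFixedPt, (hiter m u hu).2]
    exact ⟨fun h => hinj (hiter m u hu).1 hu h, fun h => congrArg w h⟩
  have hset : conjugatedPts K n g = w '' twistedPts F h n := by
    ext θ
    constructor
    · rintro ⟨hθ, i, hi⟩
      obtain ⟨u, hu, rfl⟩ := hsurj θ hθ
      rw [(hiter i u hu).2, hrel u hu _ (hiter i u hu).1] at hi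
      exact ⟨u, ⟨(hmin u hu).symm.trans hθ, i, hi⟩, rfl⟩
    · rintro ⟨u, ⟨hu, i, hi⟩, rfl⟩
      have hu' := hper u hu
      refine ⟨(hmin u hu').trans hu, i, ?_⟩
      rw [(hiter i u hu').2, hrel u hu' _ (hiter i u hu').1]
      exact hi
  rw [hset, Set.InjOn.ncard_image]
  exact hinj.mono fun u hu => hper u hu.1

variable [IsAlgClosed K]

variable (K) in
theorem fix_eq_div (hn : 2 ≤ n) (g : GL (Fin 2) (ZMod p)) :
    (fix p n g : ℚ) = (conjugatedPts K n g).ncard / n := by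
  have hn0 : (n : ℚ) ≠ 0 := by
    exact_mod_cast (by omega : n ≠ 0)
  rw [eq_div_iff hn0, ← fix_mul_eq_ncard K hn g, Nat.cast_mul]

end Values

section Prime

variable {p : ℕ} [Fact p.Prime] {n : ℕ}

theorem fix_scalar (hn : 2 ≤ n) {g : GL (Fin 2) (ZMod p)} {l : ZMod p}
    (hg : (g : Matrix (Fin 2) (Fin 2) (ZMod p)) = !![l, 0; 0, l]) :
    (fix p n g : ℚ) = 1 / n * ∑ d ∈ n.divisors, (μ d : ℚ) * (p : ℚ) ^ (n / d) := by
  let K := AlgebraicClosure (ZMod p)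
  have : CharP K p := charP_of_injective_algebraMap (algebraMap (ZMod p) K).injective p
  have hn0 : n ≠ 0 := by omega
  have hl : algebraMap (ZMod p) K l ≠ 0 := by
    have := row_ne_zero g
    simpa [hg] using this
  have H : IsFreeTwist (frobenius K p) id 1 :=
    ⟨one_pos, Function.Commute.id_right, fun x i j => by simp [Nat.modEq_one]⟩
  rw [fix_eq_div K hn, ncard_conjugatedPts_eq (F := frobenius K p) (h := id) id Set.univ
    (Set.mapsTo_univ _ _) (Set.injOn_id _) (fun _ _ => rfl) (fun θ _ => ⟨θ, trivial, rfl⟩)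
    (fun _ _ => trivial),
    H.ncard_twistedPts (c := fun m => p ^ m) hn0 (one_dvd n),
    sum_divisors_coprimePart hn0 (one_dvd n) (fun m => ((p ^ m : ℕ) : ℚ))]
  · simp
    ring
  · intro m j hm _
    simpa [iterate_frobenius] using (ncard_pow_eq_add (p := p) hm (0 : K)).1
  · intro m j hm _
    simpa [iterate_frobenius] using (ncard_pow_eq_add (p := p) hm (0 : K)).2
  · intro u _ v _
    simp [hg, hl]

theorem fix_unipotent (hn : 2 ≤ n) {g : GL (Fin 2) (ZMod p)} {l : ZMod p}
    (hg : (g : Matrix (Fin 2) (Fin 2) (ZMod p)) = !![l, l; 0, l]) :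
    (fix p n g : ℚ) = fnB p n := by
  let K := AlgebraicClosure (ZMod p)
  have : CharP K p := charP_of_injective_algebraMap (algebraMap (ZMod p) K).injective p
  have hn0 : n ≠ 0 := by omega
  have hl : algebraMap (ZMod p) K l ≠ 0 := by
    have := row_ne_zero g
    simpa [hg] using this
  have H : IsFreeTwist (frobenius K p) (fun x => x + 1) p := isFreeTwist_add_natCast
  rw [fix_eq_div K hn, ncard_conjugatedPts_eq (F := frobenius K p) (h := fun x => x + 1) id Set.univ
    (Set.mapsTo_univ _ _) (Set.injOn_id _) (fun _ _ => rfl) (fun θ _ => ⟨θ, trivial, rfl⟩)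
    (fun _ _ => trivial)]
  · rw [fnB]
    split_ifs with hpn
    · rw [H.ncard_twistedPts (c := fun m => p ^ m) hn0 hpn,
        sum_divisors_coprimePart hn0 hpn (fun m => ((p ^ m : ℕ) : ℚ))]
      · have hp : p.Prime := Fact.out
        rw [Nat.totient_prime hp, Nat.cast_sub hp.one_le]
        have : (n.divisors.filter fun d => d.Coprime p) = n.divisors.filter fun d => ¬ p ∣ d := by
          refine Finset.filter_congr fun d _ => ?_
          rw [Nat.coprime_comm, hp.coprime_iff_not_dvd]
        rw [this]
        push_cast
        ring
      · intro m j hm _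
        simpa [iterate_frobenius] using (ncard_pow_eq_add (p := p) hm (j : K)).1
      · intro m j hm _
        simpa [iterate_frobenius] using (ncard_pow_eq_add (p := p) hm (j : K)).2
    · have : twistedPts (frobenius K p) (fun x => x + 1) n = ∅ :=
        Set.eq_empty_of_forall_notMem fun x hx => hpn (H.dvd_of_mem hx)
      rw [this]
      simp
  · intro u _ v _
    have h00 : g 0 0 = l := by rw [hg]; rfl
    have h01 : g 0 1 = l := by rw [hg]; rfl
    have h10 : g 1 0 = 0 := by rw [hg]; rfl
    have h11 : g 1 1 = l := by rw [hg]; rfl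
    rw [h00, h01, h10, h11, map_zero, zero_mul, zero_add, ← mul_add_one, mul_right_inj' hl, id, id]

/-- The Möbius map is multiplication by `l / m`. Its fixed points `0` and `∞` are rational, so
Frobenius remains `u ↦ u ^ p` on `Kˣ`. -/
theorem fix_split (hn : 2 ≤ n) {g : GL (Fin 2) (ZMod p)} {l m : (ZMod p)ˣ}
    (hg : (g : Matrix (Fin 2) (Fin 2) (ZMod p)) = !![(l : ZMod p), 0; 0, (m : ZMod p)]) :
    (fix p n g : ℚ) = if orderOf (l / m) ∣ n then fnA p n (orderOf (l / m)) else 0 := by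
  let K := AlgebraicClosure (ZMod p)
  have : CharP K p := charP_of_injective_algebraMap (algebraMap (ZMod p) K).injective p
  have hn0 : n ≠ 0 := by omega
  have hp : p.Prime := Fact.out
  set ι : (ZMod p)ˣ →* Kˣ := Units.map (algebraMap (ZMod p) K) with hι
  have hιinj : Function.Injective ι := Units.map_injective (algebraMap (ZMod p) K).injective
  set a : Kˣ := ι (l / m) with ha
  have hord : orderOf a = orderOf (l / m) := orderOf_injective ι hιinj _
  have hfin : IsOfFinOrder a := by
    rw [← orderOf_pos_iff, hord]
    exact orderOf_pos _
  have hpow : a ^ (p : ℤ) = a := by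
    rw [zpow_natCast, ha, ← map_pow]
    congr 1
    ext
    simp
  have H := isFreeTwist_zpow hpow hfin
  rw [fix_eq_div K hn, ncard_conjugatedPts_eq (F := fun u : Kˣ => u ^ (p : ℤ)) (h := fun u => a * u)
    Units.val Set.univ (Set.mapsTo_univ _ _) Units.val_injective.injOn
    (fun _ _ => by simp [frobenius_def])
    ?_ (fun _ _ => trivial), ← hord]
  · split_ifs with he
    · rw [ncard_twistedPts_zpow hn0 (by simp) hpow hfin he, fnA]
      have hk0 := Nat.pos_of_dvd_of_pos (coprimePart_spec (orderOf a) hn0).1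
        (Nat.pos_of_ne_zero hn0)
      rw [← Nat.sum_div_divisors (coprimePart n (orderOf a))
        (fun d => (μ d : ℚ) * ((p : ℚ) ^ (coprimePart n (orderOf a) *
          (n / orderOf a / coprimePart n (orderOf a)) / d) - 1)), mul_div_right_comm]
      congr 1
      refine Finset.sum_congr rfl fun d hd => ?_
      have hdk := Nat.dvd_of_mem_divisors hd
      congr 1
      obtain ⟨t, ht⟩ := hdk
      generalize coprimePart n (orderOf a) = k at *
      have hd0 : 0 < d := Nat.pos_of_mem_divisors hd
      have ht0 : 0 < t := by
        rcases Nat.eq_zero_or_pos t with h | h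
        · simp [h] at ht; omega
        · exact h
      rw [ht, Nat.mul_div_cancel_left _ hd0, mul_comm d t, mul_assoc, Nat.mul_div_cancel_left _ ht0,
        mul_comm d]
      rw [← Int.cast_natCast (R := ℚ), Int.natCast_natAbs, abs_of_nonneg]
      · push_cast
        ring
      · exact sub_nonneg.2 (one_le_pow₀ (by exact_mod_cast hp.one_le))
    · rw [Set.eq_empty_of_forall_notMem fun x hx => he (H.dvd_of_mem hx)]
      simp
  · intro u _ v _
    simp only [hg]
    have hm : algebraMap (ZMod p) K m ≠ 0 := by simp
    rw [Units.ext_iff]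
    simp only [Matrix.of_apply, Matrix.cons_val', Matrix.cons_val_zero, Matrix.cons_val_one,
      Matrix.cons_val_fin_one, map_zero, add_zero, zero_mul, zero_add, Units.val_mul, ha, hι,
      map_div, Units.val_div_eq_div_val, Units.coe_map, MonoidHom.coe_coe]
    rw [div_mul_eq_mul_div, div_eq_iff hm, mul_comm (v : K)]
  · intro θ hθ
    have h0 : θ ≠ 0 := by
      rintro rfl
      have := minimalPeriod_frobenius_algebraMap (p := p) (K := K) 0
      rw [map_zero] at this
      omega
    exact ⟨Units.mk0 θ h0, trivial, rfl⟩

end Prime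

end BinaryForm

/-! ### Values of `fix` on non-split matrices. -/

namespace BinaryForm

open Function

/-- The sign of `(-p)^m` is the source of the parity term in `fnC`. -/
theorem natAbs_neg_pow_sub_one {p : ℕ} (hp : 0 < p) (m : ℕ) :
    ((((-(p : ℤ)) ^ m - 1).natAbs : ℕ) : ℚ) = (p : ℚ) ^ m - 1 + 2 * ((m % 2 : ℕ) : ℚ) := by
  have h1 : (1 : ℤ) ≤ (p : ℤ) ^ m := one_le_pow₀ (by exact_mod_cast hp)
  rw [← Int.cast_natCast (R := ℚ), Int.natCast_natAbs]
  rcases Nat.even_or_odd m with hm | hm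
  · rw [hm.neg_pow, abs_of_nonneg (by linarith), Nat.even_iff.1 hm]
    push_cast
    ring
  · rw [hm.neg_pow, abs_of_nonpos (by linarith), Nat.odd_iff.1 hm]
    push_cast
    ring

/-- For eigenvalues `L`, `L'`, the fixed points of the Möbius map are `η = (L - d) / c` and `η' =
(L' - d) / c`. In the coordinate `u = (θ - η) / (θ - η')` the map is multiplication by `L' / L`; the
fractions are the inverse coordinate `θ = (η' * u - η) / (u - 1)`. -/
theorem mobius_eq_iff {K : Type*} [Field K] {a b c d L L' u v : K} (hL : L' ≠ L) (hc : c ≠ 0)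
    (htr : L + L' = a + d) (hdet : L * L' = a * d - b * c) (hu : u - 1 ≠ 0) (hv : v - 1 ≠ 0) :
    a * (((L' - d) / c * u - (L - d) / c) / (u - 1)) + b =
      (c * (((L' - d) / c * u - (L - d) / c) / (u - 1)) + d) *
        (((L' - d) / c * v - (L - d) / c) / (v - 1)) ↔ L' * u = L * v := by
  have ha : a = L + L' - d := by linear_combination -htr
  have hb : b = (a * d - L * L') / c := by
    field_simp
    linear_combination hdet
  have h : a * (((L' - d) / c * u - (L - d) / c) / (u - 1)) + b -
      (c * (((L' - d) / c * u - (L - d) / c) / (u - 1)) + d) *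
        (((L' - d) / c * v - (L - d) / c) / (v - 1)) =
      (L' - L) * (L * v - L' * u) / (c * (u - 1) * (v - 1)) := by
    subst hb ha
    field_simp
    ring
  rw [← sub_eq_zero, h]
  simp only [div_eq_zero_iff, mul_eq_zero, sub_eq_zero, hL, hc, sub_ne_zero.1 hu, sub_ne_zero.1 hv,
    or_false, false_or]
  exact eq_comm

section Nonsplit

variable {p : ℕ} [Fact p.Prime] {n : ℕ} {K : Type*} [Field K] [Algebra (ZMod p) K] [CharP K p]

/-- Frobenius exchanges the fixed points `η` and `η'`, hence sends `u` to `u ^ (-p)`; the multiplier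
is `L ^ p / L`. The value `u = 1` is `θ = ∞`. Since `η` and `η'` have period at most `2`, the bound
`n > 2` ensures that no counted point is one of them. -/
theorem ncard_conjugatedPts_nonsplit (hn : 2 < n) {g : GL (Fin 2) (ZMod p)} {L : Kˣ}
    (hL : (L : K) ^ p ≠ L)
    (htr : (L : K) + (L : K) ^ p = algebraMap (ZMod p) K (g 0 0) + algebraMap (ZMod p) K (g 1 1))
    (hdet : (L : K) * (L : K) ^ p = algebraMap (ZMod p) K (g 0 0) * algebraMap (ZMod p) K (g 1 1) -
      algebraMap (ZMod p) K (g 0 1) * algebraMap (ZMod p) K (g 1 0)) :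
    (conjugatedPts K n g).ncard =
      (twistedPts (fun u : Kˣ => u ^ (-(p : ℤ))) (fun u => L ^ (p - 1) * u) n).ncard := by
  have hp : p.Prime := Fact.out
  have hfr : ∀ x : ZMod p, frobenius K p (algebraMap (ZMod p) K x) = algebraMap (ZMod p) K x :=
    fun x => by rw [frobenius_def, ← map_pow, ZMod.pow_card]
  have ha := hfr (g 0 0)
  have hc := hfr (g 1 0)
  have hd := hfr (g 1 1)
  rw [← frobenius_def] at hL htr hdet
  have hζ : ((L ^ (p - 1) : Kˣ) : K) = frobenius K p L / L := by
    rw [frobenius_def, eq_div_iff L.ne_zero, Units.val_pow_eq_pow_val, pow_sub_one_mul hp.ne_zero]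
  have hL2 : frobenius K p (frobenius K p L) = L := by
    have := congrArg (frobenius K p) htr
    rw [map_add, map_add, ha, hd, ← htr, add_comm] at this
    exact add_right_cancel this
  set L' := frobenius K p (L : K) with hL'
  have hL0 : (L : K) ≠ 0 := L.ne_zero
  generalize (L : K) = l at *
  -- If `c = 0`, the eigenvalues are the diagonal entries, which Frobenius fixes.
  have hc0 : algebraMap (ZMod p) K (g 1 0) ≠ 0 := by
    intro h0
    rw [h0, mul_zero, sub_zero] at hdet
    have : (l - algebraMap (ZMod p) K (g 0 0)) * (l - algebraMap (ZMod p) K (g 1 1)) = 0 := by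
      linear_combination l * htr - hdet
    rcases mul_eq_zero.1 this with h | h
    · apply hL
      rw [hL', sub_eq_zero.1 h, ha]
    · apply hL
      rw [hL', sub_eq_zero.1 h, hd]
  have hrel := fun u v : K => @mobius_eq_iff K _ _ _ _ _ l L' u v hL hc0 htr hdet
  set c := algebraMap (ZMod p) K (g 1 0)
  set d := algebraMap (ZMod p) K (g 1 1)
  set η := (l - d) / c with hη
  set η' := (L' - d) / c with hη'
  have hηη' : frobenius K p η = η' := by
    rw [hη, hη', map_div₀, map_sub, hc, hd, ← hL']
  have hη'η : frobenius K p η' = η := by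
    rw [hη, hη', map_div₀, map_sub, hc, hd, hL2]
  have hne : η' ≠ η := by
    rw [hη, hη']
    intro h
    rw [div_left_inj' hc0, sub_left_inj] at h
    exact hL h
  have hsub : ∀ {u : Kˣ}, u ≠ 1 → (u : K) - 1 ≠ 0 := fun hu h =>
    hu (Units.ext (by simpa [sub_eq_zero] using h))
  have hperη : minimalPeriod (frobenius K p) η ≤ 2 ∧ minimalPeriod (frobenius K p) η' ≤ 2 := by
    constructor
    · apply IsPeriodicPt.minimalPeriod_le two_pos
      change frobenius K p (frobenius K p η) = η
      rw [hηη', hη'η]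
    · apply IsPeriodicPt.minimalPeriod_le two_pos
      change frobenius K p (frobenius K p η') = η'
      rw [hη'η, hηη']
  refine ncard_conjugatedPts_eq (fun u : Kˣ => (η' * u - η) / (u - 1)) {u | u ≠ 1} ?_ ?_ ?_ ?_ ?_ ?_
  · intro u hu h
    apply hu
    have h1 : ((u : Kˣ) : K) ^ p = 1 := by
      simpa [zpow_neg] using congrArg Units.val h
    rw [← frobenius_def, ← map_one (frobenius K p)] at h1
    exact Units.ext (frobenius_inj K p h1)
  · intro u hu v hv h
    have h1 := hsub hu
    have h2 := hsub hv
    rw [div_eq_div_iff h1 h2] at h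
    have h3 : (η' - η) * ((u : K) - v) = 0 := by linear_combination -h
    rcases mul_eq_zero.1 h3 with h | h
    · exact absurd (sub_eq_zero.1 h) hne
    · exact Units.ext (sub_eq_zero.1 h)
  · intro u hu
    have h1 := hsub hu
    have h2 : (u : K) ^ p - 1 ≠ 0 := by
      intro h
      apply h1
      rw [← frobenius_def, ← map_one (frobenius K p), ← map_sub, map_eq_zero] at h
      exact h
    have h3 : (u : K) ^ p ≠ 0 := pow_ne_zero _ u.ne_zero
    rw [map_div₀, map_sub, map_sub, map_mul, hηη', hη'η, map_one, frobenius_def]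
    simp only [zpow_neg, zpow_natCast, Units.val_inv_eq_inv_val, Units.val_pow_eq_pow_val]
    have h4 : ((u : K) ^ p)⁻¹ - 1 = -(((u : K) ^ p - 1) / (u : K) ^ p) := by
      field_simp
      ring
    rw [h4]
    field_simp
    ring
  · intro θ hθ
    have h1 : θ - η ≠ 0 := fun h => by
      rw [sub_eq_zero] at h
      subst h
      omega
    have h2 : θ - η' ≠ 0 := fun h => by
      rw [sub_eq_zero] at h
      subst h
      omega
    have h3 : (θ - η) / (θ - η') - 1 = (η' - η) / (θ - η') := by
      field_simp
      ring
    have h4 := sub_ne_zero.2 hne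
    refine ⟨Units.mk0 ((θ - η) / (θ - η')) (div_ne_zero h1 h2), ?_, ?_⟩
    · intro h
      have := congrArg Units.val h
      rw [Units.val_mk0, Units.val_one, ← sub_eq_zero, h3] at this
      exact div_ne_zero h4 h2 this
    · simp only [Units.val_mk0]
      rw [h3]
      field_simp
      ring
  · rintro u hu rfl
    have : minimalPeriod (fun u : Kˣ => u ^ (-(p : ℤ))) 1 = 1 := by
      rw [minimalPeriod_eq_one_iff_isFixedPt, IsFixedPt, one_zpow]
    omega
  · intro u hu v hv
    refine (hrel u v (hsub hu) (hsub hv)).trans ?_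
    rw [Units.ext_iff, Units.val_mul, hζ, div_mul_eq_mul_div,
      div_eq_iff hL0, mul_comm (v : K)]

theorem fix_nonsplit [IsAlgClosed K] (hn : 2 < n) {g : GL (Fin 2) (ZMod p)} {L : Kˣ}
    (hL : (L : K) ^ p ≠ L)
    (htr : (L : K) + (L : K) ^ p = algebraMap (ZMod p) K (g 0 0) + algebraMap (ZMod p) K (g 1 1))
    (hdet : (L : K) * (L : K) ^ p = algebraMap (ZMod p) K (g 0 0) * algebraMap (ZMod p) K (g 1 1) -
      algebraMap (ZMod p) K (g 0 1) * algebraMap (ZMod p) K (g 1 0))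
    (hL2 : (L ^ (p - 1)) ^ (p + 1) = 1) :
    (fix p n g : ℚ) =
      if orderOf (L ^ (p - 1)) ∣ n then fnC p n (orderOf (L ^ (p - 1))) else 0 := by
  have hp : p.Prime := Fact.out
  have hn0 : n ≠ 0 := by omega
  rw [fix_eq_div K hn.le, ncard_conjugatedPts_nonsplit hn hL htr hdet]
  generalize L ^ (p - 1) = ζ at *
  have hfin : IsOfFinOrder ζ := isOfFinOrder_iff_pow_eq_one.2 ⟨p + 1, by omega, hL2⟩
  -- This makes multiplication by `ζ` commute with `u ↦ u ^ (-p)`.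
  have hpow : ζ ^ (-(p : ℤ)) = ζ := by
    rw [zpow_neg, inv_eq_iff_mul_eq_one, zpow_natCast, ← pow_succ, hL2]
  have H := isFreeTwist_zpow hpow hfin
  split_ifs with he
  · rw [ncard_twistedPts_zpow hn0 (by simp) hpow hfin he, fnC, mul_div_right_comm]
    simp only [natAbs_neg_pow_sub_one hp.pos]
  · rw [Set.eq_empty_of_forall_notMem fun x hx => he (H.dvd_of_mem hx)]
    simp

end Nonsplit

end BinaryForm

/-! ### Normal forms under conjugation, and matrices with given trace and determinant. -/

namespace BinaryForm

section Conjugation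

variable {F : Type*} [Field F]

theorem conj_eq_of_mul_eq {g : GL (Fin 2) F} {D h : Matrix (Fin 2) (Fin 2) F}
    (hdet : h.det ≠ 0) (hD : h * (g : Matrix (Fin 2) (Fin 2) F) = D * h) :
    ∃ h : GL (Fin 2) F, ((h * g * h⁻¹ : GL (Fin 2) F) : Matrix (Fin 2) (Fin 2) F) = D := by
  set H := Matrix.GeneralLinearGroup.mkOfDetNeZero h hdet
  have hH : (H : Matrix (Fin 2) (Fin 2) F) = h := rfl
  refine ⟨H, ?_⟩
  rw [Units.val_mul, Units.val_mul, hH, hD, ← hH, mul_assoc, ← Units.val_mul, mul_inv_cancel,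
    Units.val_one, mul_one]

theorem of_fin_two_eq {R : Type*} {a b c d a' b' c' d' : R} (h₁ : a = a') (h₂ : b = b')
    (h₃ : c = c') (h₄ : d = d') : !![a, b; c, d] = !![a', b'; c', d'] := by
  rw [h₁, h₂, h₃, h₄]

/-- The rows of the conjugating matrix are left eigenvectors of `g`; an off-diagonal entry that is
nonzero tells how to write them. -/
theorem exists_conj_eq_diagonal {g : GL (Fin 2) F} {l m : F} (hlm : l ≠ m)
    (htr : g 0 0 + g 1 1 = l + m) (hdet : g 0 0 * g 1 1 - g 0 1 * g 1 0 = l * m) :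
    ∃ h : GL (Fin 2) F,
      ((h * g * h⁻¹ : GL (Fin 2) F) : Matrix (Fin 2) (Fin 2) F) = !![l, 0; 0, m] := by
  have heta := Matrix.eta_fin_two (g : Matrix (Fin 2) (Fin 2) F)
  generalize g 0 0 = a at *
  generalize g 0 1 = b at *
  generalize g 1 0 = c at *
  generalize g 1 1 = d at *
  have hsub := sub_ne_zero.2 hlm
  by_cases hc : c = 0
  · by_cases hb : b = 0
    · subst hb hc
      have h0 : (a - l) * (a - m) = 0 := by linear_combination a * htr - hdet
      rcases mul_eq_zero.1 h0 with h | h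
      · have ha : a = l := sub_eq_zero.1 h
        have hd : d = m := by linear_combination htr - ha
        refine conj_eq_of_mul_eq (h := 1) (by simp) ?_
        rw [heta, ha, hd, one_mul, mul_one]
      · have ha : a = m := sub_eq_zero.1 h
        have hd : d = l := by linear_combination htr - ha
        refine conj_eq_of_mul_eq (h := !![0, 1; 1, 0]) (by simp) ?_
        rw [heta, ha, hd]
        simp
    · refine conj_eq_of_mul_eq (h := !![l - d, b; m - d, b]) ?_ ?_
      · rw [Matrix.det_fin_two_of, show (l - d) * b - b * (m - d) = b * (l - m) by ring]
        exact mul_ne_zero hb hsub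
      · rw [heta, Matrix.mul_fin_two, Matrix.mul_fin_two]
        refine of_fin_two_eq ?_ ?_ ?_ ?_
        · linear_combination l * htr - hdet
        · ring
        · linear_combination m * htr - hdet
        · ring
  · refine conj_eq_of_mul_eq (h := !![c, l - a; c, m - a]) ?_ ?_
    · rw [Matrix.det_fin_two_of, show c * (m - a) - (l - a) * c = -(c * (l - m)) by ring]
      exact neg_ne_zero.2 (mul_ne_zero hc hsub)
    · rw [heta, Matrix.mul_fin_two, Matrix.mul_fin_two]
      refine of_fin_two_eq ?_ ?_ ?_ ?_
      · ring
      · linear_combination l * htr - hdet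
      · ring
      · linear_combination m * htr - hdet

/-- The first row `v` is `l` times a basis vector with `v * (g - l) ≠ 0`, and the second is `v * (g
- l) / l`. By Cayley–Hamilton `(g - l)^2 = 0`, so the second row is a left eigenvector. -/
theorem exists_conj_eq_unipotent {g : GL (Fin 2) F} {l : F} (hl : l ≠ 0)
    (htr : g 0 0 + g 1 1 = l + l) (hdet : g 0 0 * g 1 1 - g 0 1 * g 1 0 = l * l)
    (hg : (g : Matrix (Fin 2) (Fin 2) F) ≠ !![l, 0; 0, l]) :
    ∃ h : GL (Fin 2) F,
      ((h * g * h⁻¹ : GL (Fin 2) F) : Matrix (Fin 2) (Fin 2) F) = !![l, l; 0, l] := by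
  have heta := Matrix.eta_fin_two (g : Matrix (Fin 2) (Fin 2) F)
  generalize g 0 0 = a at *
  generalize g 0 1 = b at *
  generalize g 1 0 = c at *
  generalize g 1 1 = d at *
  by_cases hc : c = 0
  · by_cases hb : b = 0
    · subst hb hc
      have h0 : (a - l) * (a - l) = 0 := by linear_combination a * htr - hdet
      have ha : a = l := sub_eq_zero.1 (mul_self_eq_zero.1 h0)
      have hd : d = l := by linear_combination htr - ha
      rw [ha, hd] at heta
      exact absurd heta hg
    · refine conj_eq_of_mul_eq (h := !![l, 0; a - l, b]) ?_ ?_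
      · rw [Matrix.det_fin_two_of, zero_mul, sub_zero]
        exact mul_ne_zero hl hb
      · rw [heta, Matrix.mul_fin_two, Matrix.mul_fin_two]
        refine of_fin_two_eq ?_ ?_ ?_ ?_
        · ring
        · ring
        · linear_combination a * htr - hdet
        · linear_combination b * htr
  · refine conj_eq_of_mul_eq (h := !![0, l; c, d - l]) ?_ ?_
    · rw [Matrix.det_fin_two_of, zero_mul, zero_sub]
      exact neg_ne_zero.2 (mul_ne_zero hl hc)
    · rw [heta, Matrix.mul_fin_two, Matrix.mul_fin_two]
      refine of_fin_two_eq ?_ ?_ ?_ ?_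
      · ring
      · ring
      · linear_combination c * htr
      · linear_combination d * htr - hdet

theorem trace_det_of_conj {g h : GL (Fin 2) F} {D : Matrix (Fin 2) (Fin 2) F}
    (hD : ((h * g * h⁻¹ : GL (Fin 2) F) : Matrix (Fin 2) (Fin 2) F) = D) :
    g 0 0 + g 1 1 = D 0 0 + D 1 1 ∧
      g 0 0 * g 1 1 - g 0 1 * g 1 0 = D 0 0 * D 1 1 - D 0 1 * D 1 0 := by
  rw [← Matrix.trace_fin_two, ← Matrix.trace_fin_two, ← Matrix.det_fin_two, ← Matrix.det_fin_two,
    ← hD, Units.val_mul, Units.val_mul]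
  constructor
  · rw [Matrix.trace_mul_comm, ← mul_assoc, ← Units.val_mul, inv_mul_cancel, Units.val_one, one_mul]
  · rw [Matrix.det_mul, Matrix.det_mul, mul_right_comm, ← Matrix.det_mul, ← Units.val_mul,
      mul_inv_cancel, Units.val_one, Matrix.det_one, one_mul]

end Conjugation

theorem fix_conj {p : ℕ} [Fact p.Prime] (n : ℕ) (g h : GL (Fin 2) (ZMod p)) :
    fix p n (h * g * h⁻¹) = fix p n g := by
  have : MulOpposite.op (h * g * h⁻¹) =
      (MulOpposite.op h)⁻¹ * MulOpposite.op g * ((MulOpposite.op h)⁻¹)⁻¹ := by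
    simp [mul_assoc]
  rw [fix, this, ← MulAction.smul_fixedBy, fix]
  exact (Nat.card_congr ((MulAction.toPerm (MulOpposite.op h)⁻¹).image _)).symm

section Counting

variable {p : ℕ} [Fact p.Prime]

/-- The invertible matrices with trace `t` and determinant `d`. -/
def traceDetFiber (t d : ZMod p) : Finset (GL (Fin 2) (ZMod p)) :=
  Finset.univ.filter fun g => g 0 0 + g 1 1 = t ∧ g 0 0 * g 1 1 - g 0 1 * g 1 0 = d

theorem mem_traceDetFiber {t d : ZMod p} {g : GL (Fin 2) (ZMod p)} :
    g ∈ traceDetFiber t d ↔ g 0 0 + g 1 1 = t ∧ g 0 0 * g 1 1 - g 0 1 * g 1 0 = d := by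
  simp [traceDetFiber]

theorem card_mul_eq (u : ZMod p) :
    (Finset.univ.filter fun x : ZMod p × ZMod p => x.1 * x.2 = u).card =
      if u = 0 then 2 * p - 1 else p - 1 := by
  have hfib : (Finset.univ.filter fun x : ZMod p × ZMod p => x.1 * x.2 = u).card =
      ∑ b : ZMod p, (Finset.univ.filter fun c : ZMod p => b * c = u).card := by
    rw [Finset.card_filter, Fintype.sum_prod_type]
    simp only [Finset.card_filter]
  have hb : ∀ b : ZMod p, b ≠ 0 → (Finset.univ.filter fun c : ZMod p => b * c = u).card = 1 := by
    intro b hb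
    rw [Finset.card_eq_one]
    refine ⟨b⁻¹ * u, ?_⟩
    ext c
    simp [eq_inv_mul_iff_mul_eq₀ hb]
  have hp : 1 ≤ p := (Fact.out : p.Prime).one_le
  rw [hfib, ← Finset.add_sum_erase _ _ (Finset.mem_univ (0 : ZMod p)),
    Finset.sum_congr rfl fun b hb' => hb b (Finset.ne_of_mem_erase hb')]
  rw [Finset.sum_const, Finset.card_erase_of_mem (Finset.mem_univ _), Finset.card_univ, ZMod.card]
  split_ifs with h
  · simp [h, ZMod.card]
    omega
  · simp [Ne.symm h]

/-- The entry `a` is free and determines the other diagonal entry and the product of the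
off-diagonal ones. That product is attained by `p - 1` pairs, and by `p` more when it is zero, that
is, when `a` is a root of the characteristic polynomial. -/
theorem card_traceDetFiber (t : ZMod p) {d : ZMod p} (hd : d ≠ 0) :
    (traceDetFiber t d).card + p =
      p ^ 2 + p * (Finset.univ.filter fun a : ZMod p => a * (t - a) - d = 0).card := by
  have h1 : (traceDetFiber t d).card = (Finset.univ.filter
      fun x : ZMod p × ZMod p × ZMod p => x.2.1 * x.2.2 = x.1 * (t - x.1) - d).card := by
    refine Finset.card_bij (fun g _ => (g 0 0, g 0 1, g 1 0)) ?_ ?_ ?_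
    · intro g hg
      rw [mem_traceDetFiber] at hg
      simp only [Finset.mem_filter, Finset.mem_univ, true_and]
      rw [← hg.1, ← hg.2]
      ring
    · intro g hg h hh hgh
      rw [mem_traceDetFiber] at hg hh
      simp only [Prod.mk.injEq] at hgh
      apply Units.ext
      ext i j
      fin_cases i <;> fin_cases j
      · exact hgh.1
      · exact hgh.2.1
      · exact hgh.2.2
      · have h := hg.1.trans hh.1.symm
        rw [hgh.1] at h
        exact add_left_cancel h
    · rintro ⟨a, b, c⟩ hx
      simp only [Finset.mem_filter, Finset.mem_univ, true_and] at hx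
      have hdet : (!![a, b; c, t - a] : Matrix (Fin 2) (Fin 2) (ZMod p)).det = d := by
        rw [Matrix.det_fin_two_of, hx]
        ring
      refine ⟨Matrix.GeneralLinearGroup.mkOfDetNeZero !![a, b; c, t - a] (by rwa [hdet]), ?_, rfl⟩
      rw [mem_traceDetFiber]
      rw [Matrix.det_fin_two] at hdet
      refine ⟨?_, hdet⟩
      change a + (t - a) = t
      ring
  have hp : 1 ≤ p := (Fact.out : p.Prime).one_le
  rw [h1, Finset.card_filter, Fintype.sum_prod_type]
  have h2 : ∀ a : ZMod p, (∑ y : ZMod p × ZMod p, if y.1 * y.2 = a * (t - a) - d then 1 else 0) =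
      (p - 1) + p * if a * (t - a) - d = 0 then 1 else 0 := by
    intro a
    rw [← Finset.card_filter, card_mul_eq]
    split_ifs <;> omega
  rw [Finset.sum_congr rfl fun a _ => h2 a, Finset.sum_add_distrib, ← Finset.mul_sum,
    ← Finset.card_filter, Finset.sum_const, Finset.card_univ, ZMod.card, smul_eq_mul]
  have h3 : p * (p - 1) + p = p ^ 2 := by
    obtain ⟨q, rfl⟩ := Nat.exists_eq_add_of_le hp
    simp
    ring
  omega

theorem card_traceDetFiber_of_ne {l m : ZMod p} (hl : l ≠ 0) (hm : m ≠ 0) (hlm : l ≠ m) :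
    (traceDetFiber (l + m) (l * m)).card = p ^ 2 + p := by
  have h := card_traceDetFiber (l + m) (mul_ne_zero hl hm)
  have : (Finset.univ.filter fun a : ZMod p => a * (l + m - a) - l * m = 0) = {l, m} := by
    ext a
    rw [Finset.mem_filter, show a * (l + m - a) - l * m = -((a - l) * (a - m)) by ring]
    simp [sub_eq_zero]
  rw [this, Finset.card_pair hlm] at h
  omega

theorem card_traceDetFiber_self {l : ZMod p} (hl : l ≠ 0) :
    (traceDetFiber (l + l) (l * l)).card = p ^ 2 := by
  have h := card_traceDetFiber (l + l) (mul_ne_zero hl hl)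
  have : (Finset.univ.filter fun a : ZMod p => a * (l + l - a) - l * l = 0) = {l} := by
    ext a
    rw [Finset.mem_filter, show a * (l + l - a) - l * l = -((a - l) * (a - l)) by ring]
    simp [sub_eq_zero]
  rw [this, Finset.card_singleton] at h
  omega

theorem card_traceDetFiber_of_no_root {t d : ZMod p} (hd : d ≠ 0)
    (h : ∀ a : ZMod p, a * (t - a) - d ≠ 0) : (traceDetFiber t d).card = p ^ 2 - p := by
  have h' := card_traceDetFiber t hd
  rw [Finset.filter_false_of_mem fun a _ => h a, Finset.card_empty] at h'
  omega

end Counting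

end BinaryForm

/-! ### The four classes, and the sums over those with eigenvalues in `GF(p)`. -/

namespace BinaryForm

/-- Double counting with `i` an eigenvalue datum and `M i` its matrices. Each matrix arises from two
data, which produces the factor one half in `termc` and `termd`. -/
theorem two_mul_sum_eq_mul_sum {G ι : Type*} [DecidableEq G] {S : Finset G} {P : Finset ι}
    {M : ι → Finset G} {f : G → ℚ} {v : ι → ℚ} {N : ℚ}
    (hM : ∀ i ∈ P, ∀ g ∈ M i, g ∈ S ∧ f g = v i)
    (htwo : ∀ g ∈ S, (P.filter fun i => g ∈ M i).card = 2) (hN : ∀ i ∈ P, ((M i).card : ℚ) = N) :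
    2 * ∑ g ∈ S, f g = N * ∑ i ∈ P, v i := by
  have h1 : ∑ i ∈ P, ∑ g ∈ M i, f g = ∑ g ∈ S, ∑ i ∈ P with g ∈ M i, f g := by
    refine Finset.sum_comm' fun i g => ?_
    rw [Finset.mem_filter]
    exact ⟨fun h => ⟨h, (hM i h.1 g h.2).1⟩, fun h => h.1⟩
  have h2 : ∑ i ∈ P, ∑ g ∈ M i, f g = N * ∑ i ∈ P, v i := by
    rw [Finset.mul_sum]
    refine Finset.sum_congr rfl fun i hi => ?_
    rw [Finset.sum_congr rfl fun g hg => (hM i hi g hg).2, Finset.sum_const, nsmul_eq_mul, hN i hi]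
  rw [← h2, h1, Finset.mul_sum]
  refine Finset.sum_congr rfl fun g hg => ?_
  rw [Finset.sum_const, htwo g hg, nsmul_eq_mul, Nat.cast_ofNat]

theorem sum_orderOf_of_isCyclic (C : Type*) [Group C] [Fintype C] [DecidableEq C] [IsCyclic C]
    {n : ℕ} (hn : n ≠ 0) (v : ℕ → ℚ) :
    ∑ a ∈ (Finset.univ : Finset C).erase 1, (if orderOf a ∣ n then v (orderOf a) else 0) =
      ∑ e ∈ (n.gcd (Fintype.card C)).divisors.erase 1, (e.totient : ℚ) * v e := by
  have hC : Fintype.card C ≠ 0 := Fintype.card_ne_zero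
  have hmaps : ∀ a ∈ (Finset.univ : Finset C).erase 1,
      orderOf a ∈ (Fintype.card C).divisors.erase 1 := by
    intro a ha
    rw [Finset.mem_erase, Nat.mem_divisors, Ne, orderOf_eq_one_iff]
    exact ⟨Finset.ne_of_mem_erase ha, orderOf_dvd_card, hC⟩
  rw [← Finset.sum_fiberwise_of_maps_to hmaps]
  have hset : (n.gcd (Fintype.card C)).divisors.erase 1 =
      ((Fintype.card C).divisors.erase 1).filter fun e => e ∣ n := by
    ext e
    simp only [Finset.mem_erase, Nat.mem_divisors, Finset.mem_filter, Nat.dvd_gcd_iff, ne_eq,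
      Nat.gcd_eq_zero_iff, hn, hC]
    tauto
  rw [hset, Finset.sum_filter]
  refine Finset.sum_congr rfl fun e he => ?_
  rw [Finset.mem_erase, Nat.mem_divisors] at he
  have hfil : ((Finset.univ : Finset C).erase 1).filter (fun a => orderOf a = e) =
      Finset.univ.filter fun a => orderOf a = e := by
    ext a
    simp only [Finset.mem_filter, Finset.mem_erase, Finset.mem_univ, and_true, true_and,
      and_iff_right_iff_imp]
    rintro rfl h
    exact he.1 (by rw [h, orderOf_one])
  rw [Finset.sum_congr rfl (g := fun _ => if e ∣ n then v e else 0)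
    (fun a ha => by rw [(Finset.mem_filter.1 ha).2]), Finset.sum_const, hfil,
    IsCyclic.card_orderOf_eq_totient he.2.1, nsmul_eq_mul]
  split_ifs <;> simp

section Classification

variable {p : ℕ} [Fact p.Prime]

theorem isRoot_charpoly_iff {M : Matrix (Fin 2) (Fin 2) (ZMod p)} {a : ZMod p} :
    M.charpoly.IsRoot a ↔ a * (M 0 0 + M 1 1 - a) - (M 0 0 * M 1 1 - M 0 1 * M 1 0) = 0 := by
  rw [Matrix.charpoly_fin_two, Matrix.trace_fin_two, Matrix.det_fin_two, Polynomial.IsRoot.def]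
  simp only [Polynomial.eval_add, Polynomial.eval_sub, Polynomial.eval_pow, Polynomial.eval_X,
    Polynomial.eval_mul, Polynomial.eval_C]
  constructor <;> intro h <;> linear_combination -h

theorem mem_nonsplitMatrices_iff {g : GL (Fin 2) (ZMod p)} :
    g ∈ nonsplitMatrices p ↔
      ∀ a : ZMod p, a * (g 0 0 + g 1 1 - a) - (g 0 0 * g 1 1 - g 0 1 * g 1 0) ≠ 0 := by
  rw [nonsplitMatrices, Set.mem_ofPred_eq, not_exists]
  exact forall_congr' fun a => not_congr isRoot_charpoly_iff

theorem mem_splitMatrices_iff {g : GL (Fin 2) (ZMod p)} :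
    g ∈ splitMatrices p ↔ ∃ l m : ZMod p, l ≠ m ∧ g ∈ traceDetFiber (l + m) (l * m) := by
  constructor
  · rintro ⟨l, m, h, hlm, hD⟩
    have := trace_det_of_conj hD
    exact ⟨l, m, hlm, by simpa [mem_traceDetFiber] using this⟩
  · rintro ⟨l, m, hlm, hg⟩
    rw [mem_traceDetFiber] at hg
    obtain ⟨h, hD⟩ := exists_conj_eq_diagonal hlm hg.1 hg.2
    exact ⟨l, m, h, hlm, hD⟩

theorem det_entries_ne_zero (g : GL (Fin 2) (ZMod p)) : g 0 0 * g 1 1 - g 0 1 * g 1 0 ≠ 0 := by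
  rw [← Matrix.det_fin_two]
  exact g.det.ne_zero

theorem mem_nonsemisimpleMatrices_iff {g : GL (Fin 2) (ZMod p)} :
    g ∈ nonsemisimpleMatrices p ↔
      (∃ l : ZMod p, g ∈ traceDetFiber (l + l) (l * l)) ∧ g ∉ scalarMatrices p := by
  constructor
  · rintro ⟨l, h, hD⟩
    have htd := trace_det_of_conj hD
    refine ⟨⟨l, by simpa [mem_traceDetFiber] using htd⟩, ?_⟩
    rintro ⟨m, hm⟩
    -- A scalar matrix is central, so it would equal its normal form and force the off-diagonal
    -- entry `l` to vanish.
    have hcomm : h * g * h⁻¹ = g := by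
      rw [mul_inv_eq_iff_eq_mul]
      apply Units.ext
      rw [Units.val_mul, Units.val_mul, hm, Matrix.eta_fin_two (h : Matrix (Fin 2) (Fin 2) (ZMod p)),
        Matrix.mul_fin_two, Matrix.mul_fin_two]
      refine of_fin_two_eq ?_ ?_ ?_ ?_ <;> ring
    rw [hcomm, hm] at hD
    have hl : (0 : ZMod p) = l := congrFun (congrFun hD 0) 1
    apply det_entries_ne_zero g
    rw [htd.2, ← hl]
    simp
  · rintro ⟨⟨l, hg⟩, hs⟩
    rw [mem_traceDetFiber] at hg
    have hl : l ≠ 0 := fun hl => det_entries_ne_zero g (by rw [hg.2, hl, zero_mul])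
    obtain ⟨h, hD⟩ := exists_conj_eq_unipotent hl hg.1 hg.2 fun hg' => hs ⟨l, hg'⟩
    exact ⟨l, h, hD⟩

theorem exists_mem_traceDetFiber_of_mem_scalarMatrices {g : GL (Fin 2) (ZMod p)}
    (hg : g ∈ scalarMatrices p) : ∃ l : ZMod p, g ∈ traceDetFiber (l + l) (l * l) := by
  obtain ⟨l, hl⟩ := hg
  exact ⟨l, by simp [mem_traceDetFiber, hl]⟩

theorem eq_or_eq_of_mem_traceDetFiber {l m l' m' : ZMod p} {g : GL (Fin 2) (ZMod p)}
    (h : g ∈ traceDetFiber (l + m) (l * m)) (h' : g ∈ traceDetFiber (l' + m') (l' * m')) :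
    (l' = l ∧ m' = m) ∨ (l' = m ∧ m' = l) := by
  rw [mem_traceDetFiber] at h h'
  have h1 : l' + m' = l + m := h'.1.symm.trans h.1
  have h2 : l' * m' = l * m := h'.2.symm.trans h.2
  have h3 : (l' - l) * (l' - m) = 0 := by linear_combination l' * h1 - h2
  rcases mul_eq_zero.1 h3 with h | h
  · have := sub_eq_zero.1 h
    exact Or.inl ⟨this, by linear_combination h1 - this⟩
  · have := sub_eq_zero.1 h
    exact Or.inr ⟨this, by linear_combination h1 - this⟩

theorem nonsplitMatrices_not_mem {l m : ZMod p} {g : GL (Fin 2) (ZMod p)}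
    (h : g ∈ traceDetFiber (l + m) (l * m)) : g ∉ nonsplitMatrices p := by
  rw [mem_traceDetFiber] at h
  rw [mem_nonsplitMatrices_iff, h.1, h.2]
  exact fun h' => h' l (by ring)

theorem sum_univ_eq_sum_classes (f : GL (Fin 2) (ZMod p) → ℚ) :
    ∑ g, f g = ∑ᶠ g ∈ scalarMatrices p, f g + ∑ᶠ g ∈ nonsemisimpleMatrices p, f g +
      ∑ᶠ g ∈ splitMatrices p, f g + ∑ᶠ g ∈ nonsplitMatrices p, f g := by
  rw [← finsum_mem_union _ (Set.toFinite _) (Set.toFinite _),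
    ← finsum_mem_union _ (Set.toFinite _) (Set.toFinite _),
    ← finsum_mem_union _ (Set.toFinite _) (Set.toFinite _), ← finsum_eq_sum_of_fintype,
    ← finsum_mem_univ]
  · congr! 3 with g
    refine iff_of_true trivial ?_
    by_cases hg : g ∈ nonsplitMatrices p
    · exact Or.inr hg
    · left
      rw [mem_nonsplitMatrices_iff] at hg
      push Not at hg
      obtain ⟨l, hl⟩ := hg
      -- The second eigenvalue is the trace minus `l`.
      have hmem : g ∈ traceDetFiber (l + (g 0 0 + g 1 1 - l)) (l * (g 0 0 + g 1 1 - l)) := by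
        rw [mem_traceDetFiber]
        exact ⟨by ring, by linear_combination -hl⟩
      generalize g 0 0 + g 1 1 - l = m at hmem
      by_cases hlm : l = m
      · left
        rw [← hlm] at hmem
        by_cases hs : g ∈ scalarMatrices p
        · exact Or.inl hs
        · exact Or.inr (mem_nonsemisimpleMatrices_iff.2 ⟨⟨l, hmem⟩, hs⟩)
      · exact Or.inr (mem_splitMatrices_iff.2 ⟨l, m, hlm, hmem⟩)
  · rw [Set.disjoint_left]
    rintro g ((hg | hg) | hg)
    · obtain ⟨l, hl⟩ := exists_mem_traceDetFiber_of_mem_scalarMatrices hg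
      exact nonsplitMatrices_not_mem hl
    · obtain ⟨⟨l, hl⟩, -⟩ := mem_nonsemisimpleMatrices_iff.1 hg
      exact nonsplitMatrices_not_mem hl
    · obtain ⟨l, m, -, hl⟩ := mem_splitMatrices_iff.1 hg
      exact nonsplitMatrices_not_mem hl
  · rw [Set.disjoint_left]
    intro g hg hs
    obtain ⟨l, m, hlm, hlm'⟩ := mem_splitMatrices_iff.1 hs
    have : ∃ l : ZMod p, g ∈ traceDetFiber (l + l) (l * l) :=
      hg.elim exists_mem_traceDetFiber_of_mem_scalarMatrices
        fun hg => (mem_nonsemisimpleMatrices_iff.1 hg).1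
    obtain ⟨a, ha⟩ := this
    rcases eq_or_eq_of_mem_traceDetFiber ha hlm' with h | h
    · exact hlm (h.1.trans h.2.symm)
    · exact hlm (h.1.trans h.2.symm)
  · rw [Set.disjoint_left]
    exact fun g hs hg => (mem_nonsemisimpleMatrices_iff.1 hg).2 hs

end Classification

section Sums

variable {p : ℕ} [Fact p.Prime] {n : ℕ}

theorem finsum_scalarMatrices (hn : 2 ≤ n) :
    (∑ᶠ g ∈ scalarMatrices p, (fix p n g : ℚ)) = terma p n := by
  classical
  have hset : (scalarMatrices p).toFinset =
      Finset.univ.image fun u : (ZMod p)ˣ => (Matrix.GeneralLinearGroup.scalar (Fin 2) u) := by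
    ext g
    rw [Set.mem_toFinset, Finset.mem_image]
    constructor
    · rintro ⟨l, hl⟩
      have hl0 : l ≠ 0 := by
        rintro rfl
        apply det_entries_ne_zero g
        simp [hl]
      refine ⟨Units.mk0 l hl0, Finset.mem_univ _, Units.ext ?_⟩
      rw [hl]
      ext i j
      fin_cases i <;> fin_cases j <;> simp [Matrix.scalar_apply]
    · rintro ⟨u, -, rfl⟩
      refine ⟨u, ?_⟩
      ext i j
      fin_cases i <;> fin_cases j <;> simp [Matrix.scalar_apply]
  rw [finsum_mem_eq_toFinset_sum, Finset.sum_congr rfl fun g hg => ?_, Finset.sum_const, hset,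
    Finset.card_image_of_injective, Finset.card_univ, ZMod.card_units, nsmul_eq_mul, terma,
    Nat.cast_sub (Fact.out : p.Prime).one_le, Nat.cast_one]
  · intro u v huv
    have := congrArg (fun g : GL (Fin 2) (ZMod p) => g 0 0) huv
    exact Units.ext (by simpa [Matrix.scalar_apply] using this)
  · rw [Set.mem_toFinset] at hg
    obtain ⟨l, hl⟩ := hg
    exact fix_scalar hn hl

/-- For each `l`, `p^2` matrices have the double eigenvalue `l`, and just one of them is scalar. -/
theorem finsum_nonsemisimpleMatrices (hn : 2 ≤ n) :
    (∑ᶠ g ∈ nonsemisimpleMatrices p, (fix p n g : ℚ)) = termb p n := by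
  classical
  have hset : (nonsemisimpleMatrices p).toFinset =
      Finset.univ.biUnion fun u : (ZMod p)ˣ =>
        (traceDetFiber ((u : ZMod p) + (u : ZMod p)) ((u : ZMod p) * (u : ZMod p))).erase
          (Matrix.GeneralLinearGroup.scalar (Fin 2) u) := by
    ext g
    simp only [Set.mem_toFinset, Finset.mem_biUnion, Finset.mem_univ, true_and, Finset.mem_erase,
      mem_nonsemisimpleMatrices_iff]
    constructor
    · rintro ⟨⟨l, hl⟩, hs⟩
      have hl0 : l ≠ 0 := fun h => det_entries_ne_zero g
        (by rw [(mem_traceDetFiber.1 hl).2, h, zero_mul])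
      refine ⟨Units.mk0 l hl0, fun h => hs ⟨l, ?_⟩, hl⟩
      rw [h]
      ext i j
      fin_cases i <;> fin_cases j <;> simp [Matrix.scalar_apply]
    · rintro ⟨u, hu, hg⟩
      refine ⟨⟨u, hg⟩, ?_⟩
      rintro ⟨l, hl⟩
      apply hu
      have hmem : g ∈ traceDetFiber (l + l) (l * l) := by simp [mem_traceDetFiber, hl]
      have hlu : l = u := by
        rcases eq_or_eq_of_mem_traceDetFiber hg hmem with h | h <;> exact h.1
      apply Units.ext
      rw [hl, hlu]
      ext i j
      fin_cases i <;> fin_cases j <;> simp [Matrix.scalar_apply]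
  have hp : p.Prime := Fact.out
  have hcard : (nonsemisimpleMatrices p).toFinset.card = (p - 1) * (p ^ 2 - 1) := by
    rw [hset, Finset.card_biUnion]
    · rw [Finset.sum_congr rfl (g := fun _ => p ^ 2 - 1) fun u _ => ?_, Finset.sum_const,
        Finset.card_univ, ZMod.card_units, smul_eq_mul]
      rw [Finset.card_erase_of_mem, card_traceDetFiber_self u.ne_zero]
      rw [mem_traceDetFiber]
      simp [Matrix.scalar_apply]
    · intro u _ v _ huv
      rw [Function.onFun, Finset.disjoint_left]
      intro g hg hg'
      apply huv
      apply Units.ext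
      rcases eq_or_eq_of_mem_traceDetFiber (Finset.mem_of_mem_erase hg')
        (Finset.mem_of_mem_erase hg) with h | h <;> exact h.1
  rw [finsum_mem_eq_toFinset_sum, Finset.sum_congr rfl fun g hg => ?_, Finset.sum_const, hcard,
    nsmul_eq_mul, termb, Nat.cast_mul, Nat.cast_sub hp.one_le, Nat.cast_sub (Nat.one_le_pow _ _ hp.pos),
    Nat.cast_one, Nat.cast_pow]
  rw [Set.mem_toFinset] at hg
  obtain ⟨l, h, hl⟩ := hg
  rw [← fix_conj n g h]
  exact fix_unipotent hn hl

theorem finsum_splitMatrices (hn : 2 ≤ n) :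
    (∑ᶠ g ∈ splitMatrices p, (fix p n g : ℚ)) = termc p n := by
  classical
  have hp : p.Prime := Fact.out
  have hn0 : n ≠ 0 := by omega
  have htwo := two_mul_sum_eq_mul_sum (S := (splitMatrices p).toFinset)
    (P := (Finset.univ : Finset ((ZMod p)ˣ × (ZMod p)ˣ)).filter fun x => x.1 ≠ x.2)
    (M := fun x => traceDetFiber ((x.1 : ZMod p) + x.2) (x.1 * x.2)) (f := fun g => (fix p n g : ℚ))
    (v := fun x => if orderOf (x.1 / x.2) ∣ n then fnA p n (orderOf (x.1 / x.2)) else 0)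
    (N := (p : ℚ) ^ 2 + p) ?_ ?_ ?_
  · have hsum : ∑ x : (ZMod p)ˣ × (ZMod p)ˣ with x.1 ≠ x.2,
        (if orderOf (x.1 / x.2) ∣ n then fnA p n (orderOf (x.1 / x.2)) else 0) =
        ((p : ℚ) - 1) * ∑ a ∈ (Finset.univ : Finset (ZMod p)ˣ).erase 1,
          (if orderOf a ∣ n then fnA p n (orderOf a) else 0) := by
      have : ((p : ℚ) - 1) = ∑ m : (ZMod p)ˣ, 1 := by
        simp [Nat.totient_prime hp, Nat.cast_sub hp.one_le]
      rw [this, Finset.sum_mul_sum, ← Finset.sum_product']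
      -- The summand depends only on the ratio, so `(l, m) ↦ (m, l / m)` separates off a free unit.
      refine Finset.sum_nbij' (fun x => (x.2, x.1 / x.2)) (fun x => (x.2 * x.1, x.1)) ?_ ?_ ?_ ?_ ?_
      · intro x hx
        simpa [div_eq_one] using hx
      · intro x hx
        simpa using hx
      · intro x _
        simp
      · intro x _
        simp
      · intro x _
        simp
    rw [hsum, sum_orderOf_of_isCyclic _ hn0 (fnA p n), ZMod.card_units] at htwo
    rw [finsum_mem_eq_toFinset_sum, termc]
    have h2 : ∑ e ∈ (n.gcd (p - 1)).divisors.erase 1,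
        (e.totient : ℚ) * (((p : ℚ) - 1) / 2) * ((p : ℚ) ^ 2 + p) * fnA p n e =
        (((p : ℚ) - 1) / 2) * ((p : ℚ) ^ 2 + p) *
          ∑ e ∈ (n.gcd (p - 1)).divisors.erase 1, (e.totient : ℚ) * fnA p n e := by
      rw [Finset.mul_sum]
      exact Finset.sum_congr rfl fun e _ => by ring
    rw [h2]
    linear_combination htwo / 2
  · rintro ⟨l, m⟩ hlm g hg
    simp only [Finset.mem_filter, Finset.mem_univ, true_and] at hlm
    have hlm' : (l : ZMod p) ≠ m := fun h => hlm (Units.ext h)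
    refine ⟨Set.mem_toFinset.2 (mem_splitMatrices_iff.2 ⟨l, m, hlm', hg⟩), ?_⟩
    rw [mem_traceDetFiber] at hg
    obtain ⟨h, hD⟩ := exists_conj_eq_diagonal hlm' hg.1 hg.2
    rw [← fix_conj n g h]
    exact fix_split hn hD
  · intro g hg
    rw [Set.mem_toFinset] at hg
    obtain ⟨l, m, hlm, hg⟩ := mem_splitMatrices_iff.1 hg
    have hd : l * m ≠ 0 := (mem_traceDetFiber.1 hg).2 ▸ det_entries_ne_zero g
    have hl := left_ne_zero_of_mul hd
    have hm := right_ne_zero_of_mul hd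
    rw [Finset.card_eq_two]
    refine ⟨(Units.mk0 l hl, Units.mk0 m hm), (Units.mk0 m hm, Units.mk0 l hl), ?_, ?_⟩
    · intro h
      exact hlm (congrArg Units.val (congrArg Prod.fst h))
    · ext ⟨a, b⟩
      simp only [Finset.mem_filter, Finset.mem_univ, true_and, Finset.mem_insert,
        Finset.mem_singleton, Prod.mk.injEq, Units.ext_iff, Units.val_mk0]
      constructor
      · rintro ⟨-, h⟩
        exact eq_or_eq_of_mem_traceDetFiber hg h
      · rintro (⟨h, h'⟩ | ⟨h, h'⟩)
        · rw [Ne, Units.ext_iff, h, h']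
          exact ⟨hlm, hg⟩
        · rw [Ne, Units.ext_iff, h, h', add_comm, mul_comm]
          exact ⟨hlm.symm, hg⟩
  · rintro ⟨l, m⟩ hlm
    simp only [Finset.mem_filter, Finset.mem_univ, true_and] at hlm
    rw [card_traceDetFiber_of_ne l.ne_zero m.ne_zero fun h => hlm (Units.ext h)]
    push_cast
    rfl

end Sums

end BinaryForm

/-! ### Eigenvalues of non-split matrices in the quadratic extension. -/

namespace BinaryForm

section Nonsplit

theorem pow_sub_one_eq_one_iff {p : ℕ} (hp : 1 ≤ p) {G : Type*} [Group G] (x : G) :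
    x ^ (p - 1) = 1 ↔ x ^ p = x := by
  obtain ⟨q, rfl⟩ := Nat.exists_eq_add_of_le' hp
  rw [Nat.add_sub_cancel, pow_succ, mul_eq_right]

theorem pow_sub_one_pow_add_one_eq_one_iff {p : ℕ} (hp : 1 ≤ p) {G : Type*} [Group G] (x : G) :
    (x ^ (p - 1)) ^ (p + 1) = 1 ↔ (x ^ p) ^ p = x := by
  obtain ⟨q, rfl⟩ := Nat.exists_eq_add_of_le' hp
  rw [Nat.add_sub_cancel, ← pow_mul, ← pow_mul,
    show (q + 1) * (q + 1) = q * (q + 1 + 1) + 1 by ring, pow_succ, mul_eq_right]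

theorem eq_or_eq_pow_of_add_eq_of_mul_eq {p : ℕ} {K : Type*} [Field K] {L M : Kˣ}
    (hadd : (M : K) + (M : K) ^ p = L + (L : K) ^ p)
    (hmul : (M : K) * (M : K) ^ p = L * (L : K) ^ p) : M = L ∨ M = L ^ p := by
  have h : ((M : K) - L) * (M - (L : K) ^ p) = 0 := by
    linear_combination (M : K) * hadd - hmul
  rcases mul_eq_zero.1 h with h | h
  · exact Or.inl (Units.ext (sub_eq_zero.1 h))
  · exact Or.inr (Units.ext (by rw [sub_eq_zero.1 h, Units.val_pow_eq_pow_val]))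

variable {p : ℕ} [Fact p.Prime] {n : ℕ}

theorem natCast_sub_one_ne_zero {K : Type*} [Field K] [CharP K p] : ((p - 1 : ℕ) : K) ≠ 0 := by
  rw [Nat.cast_sub (Fact.out : p.Prime).one_le]
  simp

theorem natCast_add_one_ne_zero {p : ℕ} {K : Type*} [Field K] [CharP K p] : ((p + 1 : ℕ) : K) ≠ 0 := by
  simp

variable {K : Type*} [Field K] [Algebra (ZMod p) K] [CharP K p]

theorem exists_algebraMap_eq_of_pow_eq {x : K} (hx : x ^ p = x) :
    ∃ a : ZMod p, algebraMap (ZMod p) K a = x := by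
  have h := (Subfield.mem_bot_iff_pow_eq_self (p := p) (F := K)).2 hx
  rw [← ZMod.fieldRange_castHom_eq_bot p, RingHom.mem_fieldRange] at h
  obtain ⟨a, ha⟩ := h
  exact ⟨a, by rw [← ha]; exact congrFun (congrArg _ (Subsingleton.elim _ _)) a⟩

variable (p K) in
/-- The nonzero elements of the quadratic extension of `GF(p)` that do not lie in `GF(p)`. -/
def quadraticUnits : Set Kˣ := {L | (L ^ p) ^ p = L ∧ L ^ p ≠ L}

theorem exists_trace_det {L : Kˣ} (hL : L ∈ quadraticUnits p K) :
    ∃ t d : ZMod p, algebraMap (ZMod p) K t = L + (L : K) ^ p ∧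
      algebraMap (ZMod p) K d = L * (L : K) ^ p := by
  have h1 : ((L : K) ^ p) ^ p = L := by
    rw [← Units.val_pow_eq_pow_val, ← Units.val_pow_eq_pow_val, hL.1]
  obtain ⟨t, ht⟩ := exists_algebraMap_eq_of_pow_eq (p := p) (x := (L : K) + (L : K) ^ p)
    (by rw [add_pow_char, h1, add_comm])
  obtain ⟨d, hd⟩ := exists_algebraMap_eq_of_pow_eq (p := p) (x := (L : K) * (L : K) ^ p)
    (by rw [mul_pow, h1, mul_comm])
  exact ⟨t, d, ht, hd⟩

theorem ne_algebraMap_of_mem_quadraticUnits {K : Type*} [Field K] [Algebra (ZMod p) K] {L : Kˣ}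
    (hL : L ∈ quadraticUnits p K) (a : ZMod p) :
    (L : K) ≠ algebraMap (ZMod p) K a ∧ (L : K) ^ p ≠ algebraMap (ZMod p) K a := by
  have ha : (algebraMap (ZMod p) K a) ^ p = algebraMap (ZMod p) K a := by
    rw [← map_pow, ZMod.pow_card]
  have h1 : ((L : K) ^ p) ^ p = L := by
    rw [← Units.val_pow_eq_pow_val, ← Units.val_pow_eq_pow_val, hL.1]
  constructor
  · intro h
    exact hL.2 (Units.ext (by rw [Units.val_pow_eq_pow_val, h, ha]))
  · intro h
    refine hL.2 (Units.ext ?_)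
    rw [Units.val_pow_eq_pow_val, ← h1, h, ha, ha]

theorem no_root_of_mem_quadraticUnits {K : Type*} [Field K] [Algebra (ZMod p) K]
    {L : Kˣ} (hL : L ∈ quadraticUnits p K) {t d : ZMod p}
    (ht : algebraMap (ZMod p) K t = L + (L : K) ^ p)
    (hd : algebraMap (ZMod p) K d = L * (L : K) ^ p) (a : ZMod p) : a * (t - a) - d ≠ 0 := by
  intro h
  have h1 := congrArg (algebraMap (ZMod p) K) h
  rw [map_sub, map_mul, map_sub, ht, hd, map_zero] at h1
  have h2 : ((L : K) - algebraMap (ZMod p) K a) * ((L : K) ^ p - algebraMap (ZMod p) K a) = 0 := by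
    linear_combination -h1
  obtain ⟨h3, h4⟩ := ne_algebraMap_of_mem_quadraticUnits hL a
  exact mul_ne_zero (sub_ne_zero.2 h3) (sub_ne_zero.2 h4) h2

/-- A root `x` of the characteristic polynomial in `K` is not fixed by Frobenius, so `x ^ p` is the
other root. -/
theorem exists_mem_quadraticUnits [IsAlgClosed K] {g : GL (Fin 2) (ZMod p)}
    (hg : g ∈ nonsplitMatrices p) : ∃ L ∈ quadraticUnits p K,
      algebraMap (ZMod p) K (g 0 0 + g 1 1) = L + (L : K) ^ p ∧
      algebraMap (ZMod p) K (g 0 0 * g 1 1 - g 0 1 * g 1 0) = L * (L : K) ^ p := by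
  rw [mem_nonsplitMatrices_iff] at hg
  have hd0 := det_entries_ne_zero g
  obtain ⟨x, hx⟩ := IsAlgClosed.exists_aeval_eq_zero K
    (g : Matrix (Fin 2) (Fin 2) (ZMod p)).charpoly
    (by rw [Matrix.charpoly_degree_eq_dim]; simp)
  rw [Matrix.charpoly_fin_two, Matrix.trace_fin_two, Matrix.det_fin_two] at hx
  generalize g 0 0 + g 1 1 = t at *
  generalize g 0 0 * g 1 1 - g 0 1 * g 1 0 = d at *
  simp only [map_add, map_sub, map_mul, map_pow, Polynomial.aeval_X, Polynomial.aeval_C] at hx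
  have hd0' : algebraMap (ZMod p) K d ≠ 0 := by simpa using hd0
  have hx0 : x ≠ 0 := by
    rintro rfl
    apply hd0'
    linear_combination hx
  have hfr : ∀ a : ZMod p, (algebraMap (ZMod p) K a) ^ p = algebraMap (ZMod p) K a := fun a => by
    rw [← map_pow, ZMod.pow_card]
  have hxp : x ^ p ≠ x := by
    intro h
    obtain ⟨a, rfl⟩ := exists_algebraMap_eq_of_pow_eq h
    apply hg a
    apply (algebraMap (ZMod p) K).injective
    rw [map_sub, map_mul, map_sub, map_zero]
    linear_combination -hx
  have hx2 : (x ^ p) ^ 2 - algebraMap (ZMod p) K t * x ^ p + algebraMap (ZMod p) K d = 0 := by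
    have := congrArg (frobenius K p) hx
    rw [map_add, map_sub, map_mul, map_pow, map_zero] at this
    simpa only [frobenius_def, hfr] using this
  have ht : algebraMap (ZMod p) K t = x + x ^ p := by
    have h1 : (x ^ p - x) * (x + x ^ p - algebraMap (ZMod p) K t) = 0 := by
      linear_combination hx2 - hx
    have h2 := (mul_eq_zero.1 h1).resolve_left (sub_ne_zero.2 hxp)
    linear_combination -h2
  have hd : algebraMap (ZMod p) K d = x * x ^ p := by
    linear_combination hx + x * ht
  have hxpp : (x ^ p) ^ p = x := by
    have := hfr t
    rw [ht, add_pow_char] at this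
    linear_combination this
  refine ⟨Units.mk0 x hx0, ⟨Units.ext (by simpa using hxpp), fun h => hxp ?_⟩, ht, hd⟩
  simpa using congrArg Units.val h

variable (p) in
theorem finite_quadraticUnits (K : Type*) [Field K] [CharP K p] [IsAlgClosed K] : (quadraticUnits p K).Finite := by
  have hN : (((p - 1) * (p + 1) : ℕ) : K) ≠ 0 := by
    rw [Nat.cast_mul]
    exact mul_ne_zero natCast_sub_one_ne_zero natCast_add_one_ne_zero
  refine (ncard_units_pow_eq hN 1).1.subset fun L hL => ?_
  rw [Set.mem_ofPred_eq, pow_mul,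
    pow_sub_one_pow_add_one_eq_one_iff (Fact.out : p.Prime).one_le]
  exact hL.1

/-- The map `L ↦ L ^ (p - 1)` sends these units onto the nontrivial `(p + 1)`-th roots of unity,
with fibres of size `p - 1`, and those roots of unity form a cyclic group. -/
theorem sum_quadraticUnits {K : Type*} [Field K] [CharP K p] [IsAlgClosed K] (hn : n ≠ 0) (v : ℕ → ℚ) :
    ∑ L ∈ (finite_quadraticUnits p K).toFinset,
      (if orderOf (L ^ (p - 1)) ∣ n then v (orderOf (L ^ (p - 1))) else 0) =
    ((p : ℚ) - 1) * ∑ e ∈ (n.gcd (p + 1)).divisors.erase 1, (e.totient : ℚ) * v e := by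
  classical
  have hp : p.Prime := Fact.out
  have : NeZero (p + 1) := ⟨by omega⟩
  have : Fintype (rootsOfUnity (p + 1) K) := Fintype.ofFinite _
  have hcard : Fintype.card (rootsOfUnity (p + 1) K) = p + 1 := by
    rw [← Nat.card_eq_fintype_card]
    exact (ncard_units_pow_eq (natCast_add_one_ne_zero (p := p) (K := K)) 1).2
  have hcyc := sum_orderOf_of_isCyclic (rootsOfUnity (p + 1) K) hn v
  rw [hcard] at hcyc
  rw [← hcyc]
  set T : Finset Kˣ := ((Finset.univ : Finset (rootsOfUnity (p + 1) K)).erase 1).map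
    (Function.Embedding.subtype _) with hT
  have hTmem : ∀ {z : Kˣ}, z ∈ T ↔ z ^ (p + 1) = 1 ∧ z ≠ 1 := by
    intro z
    rw [hT, Finset.mem_map]
    constructor
    · rintro ⟨w, hw, rfl⟩
      exact ⟨w.2, fun h => Finset.ne_of_mem_erase hw (Subtype.ext h)⟩
    · rintro ⟨h1, h2⟩
      exact ⟨⟨z, h1⟩, Finset.mem_erase.2 ⟨fun h => h2 (congrArg Subtype.val h), Finset.mem_univ _⟩,
        rfl⟩
  have hPmem : ∀ {L : Kˣ}, L ∈ (finite_quadraticUnits p K).toFinset ↔ L ^ (p - 1) ∈ T := by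
    intro L
    rw [Set.Finite.mem_toFinset, hTmem, Ne, pow_sub_one_eq_one_iff hp.one_le,
      pow_sub_one_pow_add_one_eq_one_iff hp.one_le]
    rfl
  rw [← Finset.sum_fiberwise_of_maps_to (g := fun L : Kˣ => L ^ (p - 1)) (t := T)
    fun L hL => hPmem.1 hL]
  have hfib : ∀ z ∈ T, ∑ L ∈ (finite_quadraticUnits p K).toFinset with L ^ (p - 1) = z,
      (if orderOf (L ^ (p - 1)) ∣ n then v (orderOf (L ^ (p - 1))) else 0) =
      ((p : ℚ) - 1) * (if orderOf z ∣ n then v (orderOf z) else 0) := by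
    intro z hz
    rw [Finset.sum_congr rfl (g := fun _ => if orderOf z ∣ n then v (orderOf z) else 0)
      (fun L hL => by rw [(Finset.mem_filter.1 hL).2]), Finset.sum_const, nsmul_eq_mul]
    congr 1
    have h1 := (ncard_units_pow_eq (natCast_sub_one_ne_zero (p := p) (K := K)) z).2
    have h2 : {u : Kˣ | u ^ (p - 1) = z} =
        ((finite_quadraticUnits p K).toFinset.filter fun L => L ^ (p - 1) = z : Finset Kˣ) := by
      ext L
      rw [Finset.mem_coe, Finset.mem_filter, hPmem, Set.mem_ofPred_eq]
      exact ⟨fun h => ⟨h ▸ hz, h⟩, fun h => h.2⟩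
    rw [h2, Set.ncard_coe_finset] at h1
    rw [h1, Nat.cast_sub hp.one_le, Nat.cast_one]
  rw [Finset.sum_congr rfl hfib, ← Finset.mul_sum, hT, Finset.sum_map]
  simp

end Nonsplit

/-! ### The non-split sum and Burnside's lemma. -/

section Final

variable {p : ℕ} [Fact p.Prime] {n : ℕ}

theorem finsum_nonsplitMatrices (hn : 2 < n) :
    (∑ᶠ g ∈ nonsplitMatrices p, (fix p n g : ℚ)) = termd p n := by
  classical
  have hp : p.Prime := Fact.out
  let K := AlgebraicClosure (ZMod p)
  have : CharP K p := charP_of_injective_algebraMap (algebraMap (ZMod p) K).injective p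
  -- Non-split matrices are indexed by an eigenvalue `L`; the two data for a matrix are `L` and `L ^
  -- p`.
  have htwo := two_mul_sum_eq_mul_sum (S := (nonsplitMatrices p).toFinset)
    (P := (finite_quadraticUnits p K).toFinset)
    (M := fun L => Finset.univ.filter fun g : GL (Fin 2) (ZMod p) =>
      algebraMap (ZMod p) K (g 0 0 + g 1 1) = L + (L : K) ^ p ∧
      algebraMap (ZMod p) K (g 0 0 * g 1 1 - g 0 1 * g 1 0) = L * (L : K) ^ p)
    (f := fun g => (fix p n g : ℚ))
    (v := fun L => if orderOf (L ^ (p - 1)) ∣ n then fnC p n (orderOf (L ^ (p - 1))) else 0)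
    (N := (p : ℚ) ^ 2 - p) ?_ ?_ ?_
  · rw [sum_quadraticUnits (by omega) (fnC p n)] at htwo
    rw [finsum_mem_eq_toFinset_sum, termd]
    have h2 : ∑ e ∈ (n.gcd (p + 1)).divisors.erase 1,
        (e.totient : ℚ) * (((p : ℚ) - 1) / 2) * ((p : ℚ) ^ 2 - p) * fnC p n e =
        (((p : ℚ) - 1) / 2) * ((p : ℚ) ^ 2 - p) *
          ∑ e ∈ (n.gcd (p + 1)).divisors.erase 1, (e.totient : ℚ) * fnC p n e := by
      rw [Finset.mul_sum]
      exact Finset.sum_congr rfl fun e _ => by ring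
    rw [h2]
    linear_combination htwo / 2
  · intro L hL g hg
    rw [Set.Finite.mem_toFinset] at hL
    simp only [Finset.mem_filter, Finset.mem_univ, true_and] at hg
    constructor
    · rw [Set.mem_toFinset, mem_nonsplitMatrices_iff]
      exact no_root_of_mem_quadraticUnits hL hg.1 hg.2
    · refine fix_nonsplit hn (fun h => hL.2 (Units.ext ?_)) ?_ ?_ ?_
      · rwa [Units.val_pow_eq_pow_val]
      · rw [← hg.1, map_add]
      · rw [← hg.2, map_sub, map_mul, map_mul]
      · rw [pow_sub_one_pow_add_one_eq_one_iff hp.one_le, hL.1]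
  · intro g hg
    rw [Set.mem_toFinset] at hg
    obtain ⟨L, hL, ht, hd⟩ := exists_mem_quadraticUnits (K := K) hg
    have h1 : ((L : K) ^ p) ^ p = L := by
      rw [← Units.val_pow_eq_pow_val, ← Units.val_pow_eq_pow_val, hL.1]
    rw [Finset.card_eq_two]
    refine ⟨L, L ^ p, hL.2.symm, ?_⟩
    ext M
    simp only [Finset.mem_filter, Finset.mem_univ, true_and, Finset.mem_insert,
      Finset.mem_singleton, Set.Finite.mem_toFinset]
    constructor
    · rintro ⟨-, h, h'⟩
      exact eq_or_eq_pow_of_add_eq_of_mul_eq (h.symm.trans ht) (h'.symm.trans hd)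
    · rintro (rfl | rfl)
      · exact ⟨hL, ht, hd⟩
      · refine ⟨⟨by rw [hL.1], by rw [hL.1]; exact hL.2.symm⟩, ?_, ?_⟩
        · rw [ht, Units.val_pow_eq_pow_val, h1, add_comm]
        · rw [hd, Units.val_pow_eq_pow_val, h1, mul_comm]
  · intro L hL
    rw [Set.Finite.mem_toFinset] at hL
    obtain ⟨t, d, ht, hd⟩ := exists_trace_det hL
    have hd0 : d ≠ 0 := by
      rintro rfl
      rw [map_zero] at hd
      exact mul_ne_zero L.ne_zero (pow_ne_zero _ L.ne_zero) hd.symm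
    have hset : (Finset.univ.filter fun g : GL (Fin 2) (ZMod p) =>
        algebraMap (ZMod p) K (g 0 0 + g 1 1) = L + (L : K) ^ p ∧
        algebraMap (ZMod p) K (g 0 0 * g 1 1 - g 0 1 * g 1 0) = L * (L : K) ^ p) =
        traceDetFiber t d := by
      ext g
      rw [Finset.mem_filter, mem_traceDetFiber, ← ht, ← hd,
        (algebraMap (ZMod p) K).injective.eq_iff, (algebraMap (ZMod p) K).injective.eq_iff]
      simp
    rw [hset, card_traceDetFiber_of_no_root hd0 (no_root_of_mem_quadraticUnits hL ht hd),
      Nat.cast_sub (Nat.le_self_pow two_ne_zero p), Nat.cast_pow]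

theorem sum_fix_eq (hn : 2 ≤ n) :
    ∑ g : GL (Fin 2) (ZMod p), (fix p n g : ℚ) =
      numOrbits p n * (Nat.card (GL (Fin 2) (ZMod p)) : ℚ) := by
  classical
  have := IrreducibleFormClass.finite (p := p) hn
  have : Fintype (IrreducibleFormClass (ZMod p) n) := Fintype.ofFinite _
  have : Fintype (GL (Fin 2) (ZMod p))ᵐᵒᵖ := Fintype.ofEquiv _ MulOpposite.opEquiv
  have : Fintype (MulAction.orbitRel.Quotient (GL (Fin 2) (ZMod p))ᵐᵒᵖ
    (IrreducibleFormClass (ZMod p) n)) := Fintype.ofFinite _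
  have h := MulAction.sum_card_fixedBy_eq_card_orbits_mul_card_group (GL (Fin 2) (ZMod p))ᵐᵒᵖ
    (IrreducibleFormClass (ZMod p) n)
  rw [numOrbits, Nat.card_congr (MulOpposite.opEquiv (α := GL (Fin 2) (ZMod p))), Nat.card_eq_fintype_card,
    Nat.card_eq_fintype_card, ← Nat.cast_mul]
  refine Eq.trans ?_ (congrArg _ h)
  rw [← Nat.cast_sum]
  congr 1
  refine Fintype.sum_equiv MulOpposite.opEquiv _ _ fun g => ?_
  rw [fix, Nat.card_eq_fintype_card]
  rfl

end Final

end BinaryForm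

theorem mainTheorem1 (p : ℕ) [Fact p.Prime] (n : ℕ) (hn : 2 < n) :
    (BinaryForm.numOrbits p n : ℚ) =
        (BinaryForm.terma p n + BinaryForm.termb p n + BinaryForm.termc p n +
          BinaryForm.termd p n) / (Nat.card (GL (Fin 2) (ZMod p)) : ℚ) ∧
      (∑ᶠ g ∈ BinaryForm.scalarMatrices p, (BinaryForm.fix p n g : ℚ)) =
        BinaryForm.terma p n ∧
      (∑ᶠ g ∈ BinaryForm.nonsemisimpleMatrices p, (BinaryForm.fix p n g : ℚ)) =
        BinaryForm.termb p n ∧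
      (∑ᶠ g ∈ BinaryForm.splitMatrices p, (BinaryForm.fix p n g : ℚ)) =
        BinaryForm.termc p n ∧
      (∑ᶠ g ∈ BinaryForm.nonsplitMatrices p, (BinaryForm.fix p n g : ℚ)) =
        BinaryForm.termd p n := by
  have ha := BinaryForm.finsum_scalarMatrices (p := p) hn.le
  have hb := BinaryForm.finsum_nonsemisimpleMatrices (p := p) hn.le
  have hc := BinaryForm.finsum_splitMatrices (p := p) hn.le
  have hd := BinaryForm.finsum_nonsplitMatrices (p := p) hn
  refine ⟨?_, ha, hb, hc, hd⟩
  have hG : (Nat.card (GL (Fin 2) (ZMod p)) : ℚ) ≠ 0 := Nat.cast_ne_zero.2 Nat.card_pos.ne'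
  rw [eq_div_iff hG, ← BinaryForm.sum_fix_eq hn.le, BinaryForm.sum_univ_eq_sum_classes, ha, hb, hc,
    hd]
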